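/- A game consists of a player set $[n]=\{1,\dots,n\}$ with $n\ge 2$, an action set $[k_i]$ with $k_i\ge 2$ for every player $i$, and for every player $i$ a total preorder $\succsim_i$ on the set $A=\prod_i [k_i]$ of action profiles; $\succ_i$ is its asymmetric part. The game is generic if for every $i$ and all distinct profiles $a,a'$ that differ only in the $i$th coordinate, $a\succ_i a'$ or $a'\succ_i a$. An action $x\in[k_i]$ of player $i$ is a best response to $a_{-i}$ if $(x,a_{-i})\succsim_i (y,a_{-i})$ for all $y\in[k_i]$, and $a\in A$ is a pure Nash equilibrium if $a_i$ is a best response to $a_{-i}$ for every $i$. The best-response graph of the game is the directed graph on $A$ with an edge $a\to b$ if and only if for some $i$ we have $a_{-i}=b_{-i}$, $b_i$ is a best response to $a_{-i}$, and $b\succ_i a$. A sink is a vertex without outgoing edges, a source is a vertex without incoming edges. The game is super-connected if its best-response graph has at least one sink and every non-sink can reach every non-source along a directed path (every vertex reaches itself). For integers $n\ge2$ and $k\ge 2$ let $\mathcal G(n,k)$ be the finite set of generic games with player set $[n]$ in which every player has action set $[k]$, and let $$\rho(n,k)=\frac{|\{g\in\mathcal G(n,k): g\text{ is super-connected}\}|}{|\{g\in\mathcal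 G(n,k): g\text{ has a pure Nash equilibrium}\}|}.$$ Proposition. There exists $c>0$ such that $\rho(n,2)\ge 1-e^{-cn}$ for all integers $n\ge 2$, and there exists $c>0$ such that $\rho(n,3)\ge 1-e^{-cn}$ for all integers $n\ge 3$. However, for every fixed integer $k\ge 4$, $\rho(n,k)\to 0$ as $n\to\infty$. -/

import Mathlib

open Filter Topology

/-- Action profiles: player `i` (an element of `Fin n`) has the `k i` actions `Fin (k i)`. -/
abbrev Profile {n : ℕ} (k : Fin n → ℕ) : Type := ∀ i : Fin n, Fin (k i)

/-- An (ordinal) game with player set `Fin n` and action sets `Fin (k i)`: every player `i` has a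
total preorder on the set of *all* action profiles; `pref i a b` means that player `i` weakly
prefers `a` to `b`. -/
@[ext]
structure Game (n : ℕ) (k : Fin n → ℕ) where
  pref : Fin n → Profile k → Profile k → Prop
  total : ∀ i a b, pref i a b ∨ pref i b a
  trans : ∀ i a b c, pref i a b → pref i b c → pref i a c

namespace Game

variable {n : ℕ} {k : Fin n → ℕ}

/-- There are finitely many games for given `n` and `k` (so that the cardinalities below are
genuine). -/
instance : Finite (Game n k) :=
  Finite.of_injective (fun g : Game n k => g.pref) (fun _ _ h => Game.ext h)

/-- Strict preference: the asymmetric part of the preference relation. -/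
def Strict (g : Game n k) (i : Fin n) (a b : Profile k) : Prop :=
  g.pref i a b ∧ ¬ g.pref i b a

/-- The action `x` of player `i` is a best response to the actions `a j`, `j ≠ i`, of the other
players (`a i` plays no role). -/
def IsBestResponse (g : Game n k) (i : Fin n) (x : Fin (k i)) (a : Profile k) : Prop :=
  ∀ y : Fin (k i), g.pref i (Function.update a i x) (Function.update a i y)

/-- `a` is a pure Nash equilibrium. -/
def IsPureNash (g : Game n k) (a : Profile k) : Prop :=
  ∀ i, g.IsBestResponse i (a i) a

/-- The game has a pure Nash equilibrium. -/
def HasPureNash (g : Game n k) : Prop := ∃ a, g.IsPureNash a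

/-- The edge relation of the best-response graph. -/
def Step (g : Game n k) (a b : Profile k) : Prop :=
  ∃ i, (∀ j, j ≠ i → a j = b j) ∧ g.IsBestResponse i (b i) a ∧ g.Strict i b a

/-- `a` is a sink of the best-response graph. -/
def IsSink (g : Game n k) (a : Profile k) : Prop := ∀ b, ¬ g.Step a b

/-- `a` is a source of the best-response graph. -/
def IsSource (g : Game n k) (a : Profile k) : Prop := ∀ b, ¬ g.Step b a

/-- `a` can reach `b` along a (possibly trivial) directed path of the best-response graph. -/
def CanReach (g : Game n k) (a b : Profile k) : Prop := Relation.ReflTransGen g.Step a b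

/-- The best-response graph has a sink, and every non-sink can reach every non-source. -/
def IsSuperConnected (g : Game n k) : Prop :=
  (∃ a, g.IsSink a) ∧ ∀ a b, ¬ g.IsSink a → ¬ g.IsSource b → g.CanReach a b

/-- No player is indifferent between two distinct profiles that differ only in the player's own
action. -/
def IsGeneric (g : Game n k) : Prop :=
  ∀ i a b, a ≠ b → (∀ j, j ≠ i → a j = b j) → g.Strict i a b ∨ g.Strict i b a

end Game

/-- The generic games with a pure Nash equilibrium. -/
def genericNashGames (n : ℕ) (k : Fin n → ℕ) : Set (Game n k) :=
  {g | g.IsGeneric ∧ g.HasPureNash}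

/-- The generic super-connected games (they all have a pure Nash equilibrium, namely a sink). -/
def genericSuperConnectedGames (n : ℕ) (k : Fin n → ℕ) : Set (Game n k) :=
  {g | g.IsGeneric ∧ g.IsSuperConnected}

/-- There is a generic game with a pure Nash equilibrium, so that the denominator in the fraction
below is positive. -/
theorem genericNashGames_ncard_pos (n : ℕ) (k : Fin n → ℕ) (hk : ∀ i, 1 ≤ k i) :
    0 < (genericNashGames n k).ncard := by
  rw [Set.ncard_pos (Set.toFinite _)]
  refine ⟨⟨fun i a b => a i ≤ b i, fun i a b => le_total _ _,
    fun i a b c => le_trans⟩, ?_, fun i => ⟨0, hk i⟩, ?_⟩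
  · intro i a b hab h
    have hne : a i ≠ b i := by
      intro hi
      apply hab
      funext j
      by_cases hj : j = i
      · subst hj; exact hi
      · exact h j hj
    rcases lt_or_gt_of_ne hne with h1 | h1
    · exact Or.inl ⟨h1.le, not_le.2 h1⟩
    · exact Or.inr ⟨h1.le, not_le.2 h1⟩
  · intro i y
    simp [Fin.le_def]

/-- The number of generic super-connected games divided by the number of generic games with a pure
Nash equilibrium, when there are `n` players with `k` actions each. -/
noncomputable def superConnectedFraction (n k : ℕ) : ℝ :=
  ((genericSuperConnectedGames n (fun _ => k)).ncard : ℝ) /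
    ((genericNashGames n (fun _ => k)).ncard : ℝ)

/-! The best-response graph of a generic game depends only on the best response on each line of the
Hamming graph. Swapping two actions on every line shows that all tables of best responses belong to
equally many generic games (`ncard_generic_eq`). The fraction is therefore a conditional probability
for a table with independent uniform entries. Equilibria exist with probability bounded below
(`le_pr_nashTables`), so it remains to bound the probability that the table is linked.

The dividing quantity is `k * (1 - 1/k)^k`. Up to constants, its `n`th power is the expected number
of lines none of whose `k` vertices is entered from another direction. On such a line the best
response is not a source, yet it is unreachable from outside the line. The quantity exceeds 1
exactly for `k ≥ 4`; code words then supply exponentially many independent candidate lines, and one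
of them almost surely blocks linkage (`pr_linkedTables_le`).

For `k = 2, 3` the same quantity, below 1, is a union bound: outside an exponentially small event,
among the `k` vertices of any line one can be entered from linearly many directions, and of any two
adjacent vertices one has linearly many outgoing moves (`pr_not_spread_le`). Hence a non-sink
reaches, and a non-source is reached from, quadratically many vertices in at most three steps. A
greedy path joins two given vertices with probability at least a constant (`exists_path_event`),
whatever their distance. The quadratic neighbourhoods leave room for `C * n` such attempts on
disjoint sets of lines, with `C` as large as desired, so failure is unlikely enough for a union
bound over all `k^(2n)` pairs (`pr_compl_linkedTables_le`).

This settles large `n`. For the remaining `n` the constant `c` is made small, which needs only that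
the fraction is positive: super-connected tables are built by induction on the number of players
from explicit ones (`nonempty_superConnected`). -/

/-! ### Uniform probability on a finite function space -/

section Probability

variable {ι α β : Type*}

/-- The probability of an event under the uniform distribution on a finite type. -/
noncomputable def pr {Ω : Type*} (E : Set Ω) : ℝ := (E.ncard : ℝ) / Nat.card Ω

theorem pr_nonneg {Ω : Type*} (E : Set Ω) : 0 ≤ pr E := by unfold pr; positivity

theorem pr_mono {Ω : Type*} [Finite Ω] {E F : Set Ω} (h : E ⊆ F) : pr E ≤ pr F := by
  unfold pr
  gcongr
  exact F.toFinite

theorem pr_univ {Ω : Type*} [Finite Ω] [Nonempty Ω] : pr (Set.univ : Set Ω) = 1 := by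
  unfold pr
  rw [Set.ncard_univ, div_self]
  exact_mod_cast Nat.card_pos.ne'

theorem pr_le_one {Ω : Type*} [Finite Ω] [Nonempty Ω] (E : Set Ω) : pr E ≤ 1 :=
  pr_univ (Ω := Ω) ▸ pr_mono (Set.subset_univ E)

theorem pr_compl {Ω : Type*} [Finite Ω] [Nonempty Ω] (E : Set Ω) : pr Eᶜ = 1 - pr E := by
  have h := Set.ncard_add_ncard_compl E
  have h0 : (0 : ℝ) < Nat.card Ω := by exact_mod_cast Nat.card_pos
  unfold pr
  rw [eq_sub_iff_add_eq, ← add_div, div_eq_one_iff_eq h0.ne']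
  have : ((E.ncard + Eᶜ.ncard : ℕ) : ℝ) = Nat.card Ω := by rw [h]
  push_cast at this
  linarith

theorem pr_union_le {Ω : Type*} (E F : Set Ω) : pr (E ∪ F) ≤ pr E + pr F := by
  unfold pr
  rw [← add_div]
  gcongr
  exact_mod_cast Set.ncard_union_le E F

theorem pr_empty {Ω : Type*} : pr (∅ : Set Ω) = 0 := by simp [pr]

theorem pr_biUnion_le {Ω J : Type*} (s : Finset J) (E : J → Set Ω) :
    pr (⋃ j ∈ s, E j) ≤ ∑ j ∈ s, pr (E j) := by
  classical
  induction s using Finset.induction_on with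
  | empty => simp [pr_empty]
  | insert a s ha ih =>
    rw [Finset.sum_insert ha, Finset.set_biUnion_insert]
    exact (pr_union_le _ _).trans (by gcongr)

theorem pr_iUnion_le {Ω J : Type*} [Fintype J] (E : J → Set Ω) :
    pr (⋃ j, E j) ≤ ∑ j, pr (E j) := by
  simpa using pr_biUnion_le Finset.univ E

/-- The law of total probability for a finite-valued random variable. -/
theorem pr_eq_sum_fiber {Ω β : Type*} [Finite Ω] [Fintype β] (Z : Ω → β) (E : Set Ω) :
    pr E = ∑ z, pr (E ∩ Z ⁻¹' {z}) := by
  classical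
  have := Fintype.ofFinite Ω
  unfold pr
  rw [← Finset.sum_div]
  congr 1
  norm_cast
  simp only [Set.ncard_eq_toFinset_card']
  rw [Finset.card_eq_sum_card_fiberwise (f := Z) (t := Finset.univ) (fun _ _ => by simp)]
  refine Finset.sum_congr rfl fun z _ => ?_
  congr 1
  ext x
  simp

/-- The event `E` depends only on the coordinates in `S`. -/
def DepOn (E : Set (ι → α)) (S : Set ι) : Prop :=
  ∀ ω ω' : ι → α, (∀ i ∈ S, ω i = ω' i) → ω ∈ E → ω' ∈ E

theorem DepOn.mono {E : Set (ι → α)} {S T : Set ι} (h : DepOn E S) (hST : S ⊆ T) : DepOn E T :=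
  fun ω ω' hω => h ω ω' fun i hi => hω i (hST hi)

theorem DepOn.compl {E : Set (ι → α)} {S : Set ι} (h : DepOn E S) : DepOn Eᶜ S :=
  fun ω ω' hω hE hE' => hE (h ω' ω (fun i hi => (hω i hi).symm) hE')

theorem DepOn.inter {E F : Set (ι → α)} {S T : Set ι} (hE : DepOn E S) (hF : DepOn F T) :
    DepOn (E ∩ F) (S ∪ T) :=
  fun ω ω' hω h => ⟨hE ω ω' (fun i hi => hω i (Or.inl hi)) h.1,
    hF ω ω' (fun i hi => hω i (Or.inr hi)) h.2⟩

theorem DepOn.biInter {J : Type*} {s : Set J} {E : J → Set (ι → α)} {S : J → Set ι}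
    (h : ∀ j ∈ s, DepOn (E j) (S j)) : DepOn (⋂ j ∈ s, E j) (⋃ j ∈ s, S j) := by
  intro ω ω' hω hE
  simp only [Set.mem_iInter] at hE ⊢
  exact fun j hj => h j hj ω ω'
    (fun i hi => hω i (Set.mem_iUnion₂.2 ⟨j, hj, hi⟩)) (hE j hj)

/-- Events depending on disjoint sets of coordinates are independent. -/
theorem pr_inter [Finite ι] [Finite α] {E F : Set (ι → α)} {S T : Set ι}
    (hE : DepOn E S) (hF : DepOn F T) (hST : Disjoint S T) : pr (E ∩ F) = pr E * pr F := by
  classical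
  -- Interchanging the coordinates in `S` or off `S` between two samples is an involution that
  -- carries `E ×ˢ F` onto `(E ∩ F) ×ˢ univ`.
  let φ : (ι → α) × (ι → α) → (ι → α) × (ι → α) := fun p =>
    (fun i => if i ∈ S then p.1 i else p.2 i, fun i => if i ∈ S then p.2 i else p.1 i)
  have hφ : ∀ p, φ (φ p) = p := by
    rintro ⟨u, v⟩
    simp only [φ, Prod.mk.injEq]
    constructor <;> · funext i; split_ifs <;> rfl
  have himg : φ '' (E ×ˢ F) = (E ∩ F) ×ˢ Set.univ := by
    have key : ∀ p, p ∈ E ×ˢ F ↔ φ p ∈ (E ∩ F) ×ˢ (Set.univ : Set (ι → α)) := by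
      rintro ⟨u, v⟩
      simp only [Set.mem_prod, Set.mem_inter_iff, Set.mem_univ, and_true, φ]
      constructor
      · rintro ⟨hu, hv⟩
        refine ⟨hE u _ (fun i hi => by simp [hi]) hu, hF v _ (fun i hi => ?_) hv⟩
        have : i ∉ S := fun h => Set.disjoint_left.1 hST h hi
        simp [this]
      · rintro ⟨hu, hv⟩
        refine ⟨hE _ u (fun i hi => by simp [hi]) hu, hF _ v (fun i hi => ?_) hv⟩
        have : i ∉ S := fun h => Set.disjoint_left.1 hST h hi
        simp [this]
    ext p
    constructor
    · rintro ⟨q, hq, rfl⟩; exact (key q).1 hq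
    · intro hp; exact ⟨φ p, (key _).2 (by rwa [hφ]), hφ p⟩
  have hcard : E.ncard * F.ncard = (E ∩ F).ncard * Nat.card (ι → α) := by
    rw [← Set.ncard_prod, ← Set.ncard_image_of_injective (E ×ˢ F)
      (Function.LeftInverse.injective hφ), himg, Set.ncard_prod, Set.ncard_univ]
  unfold pr
  rcases Nat.eq_zero_or_pos (Nat.card (ι → α)) with h0 | h0
  · simp [h0]
  · have h0' : (0 : ℝ) < Nat.card (ι → α) := by exact_mod_cast h0
    have : ((E.ncard : ℝ)) * F.ncard = (E ∩ F).ncard * Nat.card (ι → α) := by exact_mod_cast hcard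
    rw [div_mul_div_comm, this]
    field_simp

theorem pr_biInter [Finite ι] [Finite α] [Nonempty (ι → α)] {J : Type*} (s : Finset J)
    {E : J → Set (ι → α)}
    {S : J → Set ι} (hE : ∀ j ∈ s, DepOn (E j) (S j))
    (hS : (s : Set J).PairwiseDisjoint S) : pr (⋂ j ∈ s, E j) = ∏ j ∈ s, pr (E j) := by
  classical
  induction s using Finset.induction_on with
  | empty => simp [pr_univ]
  | insert a s ha ih =>
    rw [Finset.prod_insert ha, Finset.set_biInter_insert, ← ih
      (fun j hj => hE j (Finset.mem_insert_of_mem hj))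
      (hS.subset (by simp))]
    refine pr_inter (hE a (Finset.mem_insert_self a s))
      (DepOn.biInter (s := (s : Set J)) (fun j hj => hE j (Finset.mem_insert_of_mem hj))) ?_
    rw [Set.disjoint_iUnion₂_right]
    intro j hj
    exact hS (by simp) (by simpa using Or.inr hj) (by rintro rfl; exact ha hj)

theorem pr_iInter [Finite ι] [Finite α] [Nonempty (ι → α)] {J : Type*} [Fintype J]
    {E : J → Set (ι → α)} {S : J → Set ι} (hE : ∀ j, DepOn (E j) (S j))
    (hS : Pairwise (Function.onFun Disjoint S)) : pr (⋂ j, E j) = ∏ j, pr (E j) := by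
  have := pr_biInter Finset.univ (fun j _ => hE j) (fun i _ j _ h => hS h)
  simpa using this

theorem depOn_preimage {Z : (ι → α) → β} {S : Set ι}
    (hZ : ∀ ω ω' : ι → α, (∀ i ∈ S, ω i = ω' i) → Z ω = Z ω') (B : Set β) :
    DepOn (Z ⁻¹' B) S := fun ω ω' h hω => by
  simpa [hZ ω ω' h] using hω

/-- Conditioning on `Z`, lower bound. -/
theorem le_pr_of_cond [Finite ι] [Finite α] [Fintype β] {Z : (ι → α) → β} {S₀ : Set ι}
    (hZ : ∀ ω ω' : ι → α, (∀ i ∈ S₀, ω i = ω' i) → Z ω = Z ω') {B : Set β}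
    {E : β → Set (ι → α)} {S : β → Set ι} (hE : ∀ z ∈ B, DepOn (E z) (S z))
    (hS : ∀ z ∈ B, Disjoint S₀ (S z)) {p : ℝ} (hp : ∀ z ∈ B, p ≤ pr (E z)) :
    pr (Z ⁻¹' B) * p ≤ pr {ω | Z ω ∈ B ∧ ω ∈ E (Z ω)} := by
  classical
  rw [pr_eq_sum_fiber Z (Z ⁻¹' B), pr_eq_sum_fiber Z {ω | Z ω ∈ B ∧ ω ∈ E (Z ω)}, Finset.sum_mul]
  refine Finset.sum_le_sum fun z _ => ?_
  by_cases hz : z ∈ B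
  · have h1 : Z ⁻¹' B ∩ Z ⁻¹' {z} = Z ⁻¹' {z} := by
      ext ω; simp only [Set.mem_inter_iff, Set.mem_preimage, Set.mem_singleton_iff]
      exact ⟨fun h => h.2, fun h => ⟨h ▸ hz, h⟩⟩
    have h2 : {ω | Z ω ∈ B ∧ ω ∈ E (Z ω)} ∩ Z ⁻¹' {z} = Z ⁻¹' {z} ∩ E z := by
      ext ω; simp only [Set.mem_inter_iff, Set.mem_preimage, Set.mem_singleton_iff,
        Set.mem_ofPred_eq]
      constructor
      · rintro ⟨⟨_, h⟩, rfl⟩; exact ⟨rfl, h⟩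
      · rintro ⟨rfl, h⟩; exact ⟨⟨hz, h⟩, rfl⟩
    rw [h1, h2, pr_inter (depOn_preimage hZ {z}) (hE z hz) (hS z hz)]
    exact mul_le_mul_of_nonneg_left (hp z hz) (pr_nonneg _)
  · have h1 : Z ⁻¹' B ∩ Z ⁻¹' {z} = ∅ := by
      ext ω; simp only [Set.mem_inter_iff, Set.mem_preimage, Set.mem_singleton_iff,
        Set.mem_empty_iff_false, iff_false, not_and]
      rintro h rfl; exact hz h
    rw [h1, pr_empty, zero_mul]
    exact pr_nonneg _

/-- Conditioning on `Z`, upper bound. -/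
theorem pr_le_of_cond [Finite ι] [Finite α] [Nonempty (ι → α)] [Fintype β]
    {Z : (ι → α) → β} {S₀ : Set ι}
    (hZ : ∀ ω ω' : ι → α, (∀ i ∈ S₀, ω i = ω' i) → Z ω = Z ω') {B : Set β}
    {E : β → Set (ι → α)} {S : β → Set ι} (hE : ∀ z ∈ B, DepOn (E z) (S z))
    (hS : ∀ z ∈ B, Disjoint S₀ (S z)) {p : ℝ} (hp : ∀ z ∈ B, pr (E z) ≤ p) (hp0 : 0 ≤ p) :
    pr {ω | Z ω ∈ B ∧ ω ∈ E (Z ω)} ≤ p := by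
  -- The upper bound is the lower bound for the complementary events, subtracted from `pr (Z ⁻¹'
  -- B)`.
  have h := le_pr_of_cond hZ (B := B) (fun z hz => (hE z hz).compl) hS (p := 1 - p)
    (fun z hz => by rw [pr_compl]; linarith [hp z hz])
  have h2 : Z ⁻¹' B = {ω | Z ω ∈ B ∧ ω ∈ E (Z ω)} ∪ {ω | Z ω ∈ B ∧ ω ∈ (E (Z ω))ᶜ} := by
    ext ω; simp only [Set.mem_preimage, Set.mem_union, Set.mem_ofPred_eq, Set.mem_compl_iff]; tauto
  have h3 : pr (Z ⁻¹' B) = pr {ω | Z ω ∈ B ∧ ω ∈ E (Z ω)}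
      + pr {ω | Z ω ∈ B ∧ ω ∈ (E (Z ω))ᶜ} := by
    unfold pr
    rw [← add_div]
    congr 1
    rw [h2]
    norm_cast
    refine Set.ncard_union_eq ?_
    rw [Set.disjoint_left]
    rintro ω ⟨_, h⟩ ⟨_, h'⟩
    exact h' h
  have h4 := pr_le_one (Z ⁻¹' B)
  nlinarith

/-- Independent constraints on the individual coordinates. -/
theorem pr_forall_mem [Fintype ι] [Fintype α] (A : ι → Finset α) :
    pr {ω : ι → α | ∀ i, ω i ∈ A i} = ∏ i, ((A i).card / Fintype.card α : ℝ) := by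
  classical
  unfold pr
  have : {ω : ι → α | ∀ i, ω i ∈ A i} = (Fintype.piFinset A : Set (ι → α)) := by
    ext ω; simp
  rw [this, Set.ncard_coe_finset, Fintype.card_piFinset, Finset.prod_div_distrib]
  simp

/-- A family of constraints on distinct coordinates. -/
theorem pr_forall_mem_of_injective [Fintype ι] [Fintype α] [Nonempty α] {J : Type*} [Fintype J]
    {c : J → ι} (hc : Function.Injective c) (A : J → Finset α) :
    pr {ω : ι → α | ∀ j, ω (c j) ∈ A j} = ∏ j, ((A j).card / Fintype.card α : ℝ) := by
  classical
  have h0 : (Fintype.card α : ℝ) ≠ 0 := by exact_mod_cast Fintype.card_ne_zero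
  let A' : ι → Finset α := fun i => if h : ∃ j, c j = i then A h.choose else Finset.univ
  have hA' : ∀ j, A' (c j) = A j := by
    intro j
    have h : ∃ j', c j' = c j := ⟨j, rfl⟩
    simp only [A', h, dif_pos]
    rw [hc h.choose_spec]
  have : {ω : ι → α | ∀ j, ω (c j) ∈ A j} = {ω | ∀ i, ω i ∈ A' i} := by
    ext ω
    simp only [Set.mem_ofPred_eq]
    constructor
    · intro h i
      by_cases hi : ∃ j, c j = i
      · obtain ⟨j, rfl⟩ := hi; rw [hA']; exact h j
      · simp [A', hi]
    · intro h j; rw [← hA']; exact h _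
  rw [this, pr_forall_mem, ← Finset.prod_subset (Finset.subset_univ (Finset.univ.image c)),
    Finset.prod_image (fun _ _ _ _ h => hc h)]
  · exact Finset.prod_congr rfl fun j _ => by rw [hA']
  · intro i _ hi
    have : ¬ ∃ j, c j = i := by simpa using hi
    simp only [A', this, dif_neg, not_false_iff, Finset.card_univ]
    exact div_self h0

end Probability

/-! ### The random best-response table -/

/-- The lines of the Hamming graph: a direction and the other players' actions. -/
abbrev Line (n k : ℕ) : Type := Σ i : Fin n, ({j : Fin n // j ≠ i} → Fin k)

/-- The line through `a` in direction `i`. -/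
def lineOf {n k : ℕ} (i : Fin n) (a : Fin n → Fin k) : Line n k := ⟨i, fun j => a j⟩

section Model

variable {n k : ℕ}

theorem lineOf_eq_iff {i i' : Fin n} {a a' : Fin n → Fin k} :
    lineOf i a = lineOf i' a' ↔ i = i' ∧ ∀ j, j ≠ i → a j = a' j := by
  constructor
  · intro h
    unfold lineOf at h
    obtain ⟨rfl, h2⟩ := Sigma.mk.inj_iff.1 h
    exact ⟨rfl, fun j hj => congrFun (eq_of_heq h2) ⟨j, hj⟩⟩
  · rintro ⟨rfl, h⟩
    unfold lineOf
    congr 1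
    funext j
    exact h j j.2

@[simp] theorem lineOf_update (i : Fin n) (a : Fin n → Fin k) (x : Fin k) :
    lineOf i (Function.update a i x) = lineOf i a :=
  lineOf_eq_iff.2 ⟨rfl, fun j hj => by simp [hj]⟩

theorem exists_lineOf_eq [NeZero k] (l : Line n k) : ∃ i a, lineOf i a = l := by
  obtain ⟨i, r⟩ := l
  refine ⟨i, fun j => if h : j = i then 0 else r ⟨j, h⟩, ?_⟩
  unfold lineOf
  congr 1
  funext j
  simp [j.2]

/-- The edges of the best-response graph of a best-response table. -/
def Move (ω : Line n k → Fin k) (a b : Fin n → Fin k) : Prop :=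
  ∃ i, b = Function.update a i (ω (lineOf i a)) ∧ a i ≠ ω (lineOf i a)

/-- Reachability in the best-response graph of a best-response table. -/
def Reach (ω : Line n k → Fin k) : (Fin n → Fin k) → (Fin n → Fin k) → Prop :=
  Relation.ReflTransGen (Move ω)

/-- The tables with a pure Nash equilibrium. -/
def nashTables (n k : ℕ) : Set (Line n k → Fin k) := {ω | ∃ a, ∀ i, ω (lineOf i a) = a i}

/-- The tables in which every non-sink reaches every non-source. -/
def linkedTables (n k : ℕ) : Set (Line n k → Fin k) :=
  {ω | ∀ a b, (∃ a', Move ω a a') → (∃ b', Move ω b' b) → Reach ω a b}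

/-- `ω` is the best-response table of `g`. -/
def IsTable (g : Game n (fun _ => k)) (ω : Line n k → Fin k) : Prop :=
  ∀ i a, g.IsBestResponse i (ω (lineOf i a)) a

end Model

namespace Game

variable {n k : ℕ} {g : Game n (fun _ => k)}

theorem pref_refl (g : Game n (fun _ => k)) (i : Fin n) (a) : g.pref i a a :=
  (g.total i a a).elim id id

theorem IsGeneric.bestResponse_unique (hg : g.IsGeneric) {i : Fin n} {x y : Fin k}
    {a : Fin n → Fin k} (hx : g.IsBestResponse i x a) (hy : g.IsBestResponse i y a) : x = y := by
  by_contra hne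
  have h1 : Function.update a i x ≠ Function.update a i y := fun h => hne <| by
    simpa using congrFun h i
  rcases hg i _ _ h1 (fun j hj => by simp [hj]) with h | h
  · exact h.2 (hy x)
  · exact h.2 (hx y)

theorem exists_bestResponse [NeZero k] (g : Game n (fun _ => k)) (i : Fin n) (a : Fin n → Fin k) :
    ∃ x : Fin k, g.IsBestResponse i x a := by
  have key : ∀ s : Finset (Fin k), s.Nonempty → ∃ x ∈ s, ∀ y ∈ s,
      g.pref i (Function.update a i x) (Function.update a i y) := by
    intro s hs
    induction hs using Finset.Nonempty.cons_induction with
    | singleton x => exact ⟨x, by simp, by simpa using g.pref_refl i _⟩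
    | cons x s hx hs ih =>
      obtain ⟨z, hz, hz'⟩ := ih
      rcases g.total i (Function.update a i x) (Function.update a i z) with h | h
      · refine ⟨x, by simp, fun y hy => ?_⟩
        rcases Finset.mem_cons.1 hy with rfl | hy
        · exact g.pref_refl i _
        · exact g.trans i _ _ _ h (hz' y hy)
      · refine ⟨z, by simp [hz], fun y hy => ?_⟩
        rcases Finset.mem_cons.1 hy with rfl | hy
        · exact h
        · exact hz' y hy
  obtain ⟨x, -, hx⟩ := key Finset.univ ⟨0, by simp⟩
  exact ⟨x, fun y => hx y (by simp)⟩

theorem isBestResponse_congr (g : Game n (fun _ => k)) {i : Fin n} {a a' : Fin n → Fin k}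
    (h : ∀ j, j ≠ i → a j = a' j) (x : Fin k) :
    g.IsBestResponse i x a ↔ g.IsBestResponse i x a' := by
  have : ∀ y : Fin k, Function.update a i y = Function.update a' i y := fun y => by
    funext j
    by_cases hj : j = i
    · subst hj; simp
    · simp [hj, h j hj]
  unfold IsBestResponse
  simp [this]

theorem exists_isTable [NeZero k] (g : Game n (fun _ => k)) : ∃ ω, IsTable g ω := by
  choose f hf using g.exists_bestResponse
  choose i a hia using exists_lineOf_eq (n := n) (k := k)
  refine ⟨fun l => f (i l) (a l), fun j b => ?_⟩
  have h := hia (lineOf j b)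
  generalize hl : lineOf j b = l at h ⊢
  have h2 := hia l
  rw [← hl] at h2
  obtain ⟨h3, h4⟩ := lineOf_eq_iff.1 h2
  rw [hl] at h3 h4
  subst h3
  exact (g.isBestResponse_congr h4 _).1 (hf _ _)

theorem IsGeneric.isTable_unique [NeZero k] (hg : g.IsGeneric) {ω ω' : Line n k → Fin k}
    (h : IsTable g ω) (h' : IsTable g ω') : ω = ω' := by
  funext l
  obtain ⟨i, a, rfl⟩ := exists_lineOf_eq l
  exact hg.bestResponse_unique (h i a) (h' i a)

theorem IsGeneric.isBestResponse_iff (hg : g.IsGeneric) {ω : Line n k → Fin k}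
    (h : IsTable g ω) {i : Fin n} {x : Fin k} {a : Fin n → Fin k} :
    g.IsBestResponse i x a ↔ x = ω (lineOf i a) :=
  ⟨fun hx => hg.bestResponse_unique hx (h i a), fun hx => hx ▸ h i a⟩

theorem IsGeneric.step_iff (hg : g.IsGeneric) {ω : Line n k → Fin k}
    (h : IsTable g ω) {a b : Fin n → Fin k} : g.Step a b ↔ Move ω a b := by
  constructor
  · rintro ⟨i, h1, h2, h3⟩
    rw [hg.isBestResponse_iff h] at h2
    have hb : b = Function.update a i (ω (lineOf i a)) := by
      funext j
      by_cases hj : j = i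
      · subst hj; simp [h2]
      · simp [hj, h1 j hj]
    refine ⟨i, hb, fun hne => ?_⟩
    rw [← hne, Function.update_eq_self] at hb
    subst hb
    exact h3.2 h3.1
  · rintro ⟨i, rfl, hne⟩
    have hBR := h i a
    refine ⟨i, fun j hj => by simp [hj], by simpa using hBR, ?_⟩
    have h1 : g.pref i (Function.update a i (ω (lineOf i a))) a := by simpa using hBR (a i)
    rcases hg i (Function.update a i (ω (lineOf i a))) a
      (fun h => hne <| by simpa using (congrFun h i).symm) (fun j hj => by simp [hj]) with h2 | h2
    · exact h2
    · exact absurd h1 h2.2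

theorem IsGeneric.hasPureNash_iff (hg : g.IsGeneric) {ω : Line n k → Fin k}
    (h : IsTable g ω) : g.HasPureNash ↔ ω ∈ nashTables n k := by
  refine exists_congr fun a => forall_congr' fun i => ?_
  rw [hg.isBestResponse_iff h, eq_comm]

theorem IsGeneric.isSuperConnected_iff (hg : g.IsGeneric) {ω : Line n k → Fin k}
    (h : IsTable g ω) : g.IsSuperConnected ↔ ω ∈ nashTables n k ∩ linkedTables n k := by
  have hstep : g.Step = Move ω := by
    funext a b; exact propext (hg.step_iff h)
  unfold IsSuperConnected IsSink IsSource CanReach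
  rw [hstep]
  refine and_congr (exists_congr fun a => ?_) ?_
  · constructor
    · intro ha i
      by_contra hne
      exact ha _ ⟨i, rfl, fun h => hne h.symm⟩
    · rintro ha b ⟨i, -, hne⟩
      exact hne (ha i).symm
  · refine forall_congr' fun a => forall_congr' fun b => ?_
    simp only [not_forall, not_not]
    rfl

/-- Transport of the preferences of player `i` by a permutation of the profiles. -/
def relabel (g : Game n (fun _ => k)) (σ : Fin n → (Fin n → Fin k) → (Fin n → Fin k)) :
    Game n (fun _ => k) where
  pref i a b := g.pref i (σ i a) (σ i b)
  total i _ _ := g.total i _ _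
  trans i _ _ _ := g.trans i _ _ _

end Game

/-! ### Counting generic games by their best-response table -/

section Reduction

variable {n k : ℕ}

/-- On each line, exchange the best responses of two tables. -/
def exchange (ω ω' : Line n k → Fin k) (i : Fin n) (a : Fin n → Fin k) : Fin n → Fin k :=
  Function.update a i (Equiv.swap (ω (lineOf i a)) (ω' (lineOf i a)) (a i))

theorem exchange_exchange (ω ω' : Line n k → Fin k) (i : Fin n) (a : Fin n → Fin k) :
    exchange ω ω' i (exchange ω ω' i a) = a := by
  simp [exchange]

theorem exchange_update (ω ω' : Line n k → Fin k) (i : Fin n) (a : Fin n → Fin k) (x : Fin k) :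
    exchange ω ω' i (Function.update a i x) =
      Function.update a i (Equiv.swap (ω (lineOf i a)) (ω' (lineOf i a)) x) := by
  simp [exchange]

/-- The generic games with a given best-response table. -/
def gamesWith (ω : Line n k → Fin k) : Set (Game n (fun _ => k)) :=
  {g | g.IsGeneric ∧ IsTable g ω}

/-- The exchange permutes every line within itself, so strictness on lines survives, and it sends
the entry of `ω'` to that of `ω`, which was the best response. -/
theorem relabel_mem_gamesWith {ω ω' : Line n k → Fin k} {g : Game n (fun _ => k)}
    (hg : g ∈ gamesWith ω) : g.relabel (exchange ω ω') ∈ gamesWith ω' := by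
  constructor
  · intro i a b hab h
    refine hg.1 i _ _ (fun he => hab ?_) (fun j hj => ?_)
    · rw [← exchange_exchange ω ω' i a, he, exchange_exchange]
    · simp [exchange, hj, h j hj]
  · intro i a y
    change g.pref i (exchange ω ω' i _) (exchange ω ω' i _)
    rw [exchange_update, exchange_update, Equiv.swap_apply_right]
    exact hg.2 i a _

theorem relabel_relabel (ω ω' : Line n k → Fin k) (g : Game n (fun _ => k)) :
    (g.relabel (exchange ω ω')).relabel (exchange ω ω') = g := by
  ext i a b
  simp [Game.relabel, exchange_exchange]

theorem ncard_gamesWith_le (ω ω' : Line n k → Fin k) :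
    (gamesWith ω).ncard ≤ (gamesWith ω').ncard :=
  Set.ncard_le_ncard_of_injOn (fun g => g.relabel (exchange ω ω'))
    (fun _ hg => relabel_mem_gamesWith hg)
    (fun g _ g' _ h => by
      have := congrArg (fun g => g.relabel (exchange ω ω')) h
      simpa only [relabel_relabel] using this) (Set.toFinite _)

theorem ncard_gamesWith_eq (ω ω' : Line n k → Fin k) :
    (gamesWith ω).ncard = (gamesWith ω').ncard :=
  (ncard_gamesWith_le ω ω').antisymm (ncard_gamesWith_le ω' ω)

/-- All tables are best-response tables of equally many generic games. -/
theorem ncard_generic_eq [NeZero k] (T : Set (Line n k → Fin k)) (ω₀ : Line n k → Fin k)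
    (P : Set (Game n (fun _ => k)))
    (hP : ∀ g ω, g.IsGeneric → IsTable g ω → (g ∈ P ↔ ω ∈ T)) :
    {g : Game n (fun _ => k) | g.IsGeneric ∧ g ∈ P}.ncard = T.ncard * (gamesWith ω₀).ncard := by
  classical
  have := Fintype.ofFinite (Game n (fun _ => k))
  choose τ hτ using Game.exists_isTable (n := n) (k := k)
  simp only [Set.ncard_eq_toFinset_card']
  rw [Finset.card_eq_sum_card_fiberwise (f := τ) (t := T.toFinset)]
  · rw [Finset.sum_const_nat (m := (gamesWith ω₀).toFinset.card)]
    intro ω hω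
    rw [← Set.ncard_eq_toFinset_card', ncard_gamesWith_eq ω₀ ω, Set.ncard_eq_toFinset_card']
    congr 1
    ext g
    rw [Finset.mem_filter, Set.mem_toFinset, Set.mem_toFinset]
    change (g.IsGeneric ∧ g ∈ P) ∧ τ g = ω ↔ g.IsGeneric ∧ IsTable g ω
    constructor
    · rintro ⟨⟨h1, h2⟩, rfl⟩; exact ⟨h1, hτ g⟩
    · rintro ⟨h1, h2⟩
      exact ⟨⟨h1, (hP g ω h1 h2).2 (by simpa using hω)⟩, h1.isTable_unique (hτ g) h2⟩
  · intro g hg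
    have hg' : g.IsGeneric ∧ g ∈ P := by simpa using hg
    simpa using (hP g _ hg'.1 (hτ g)).1 hg'.2

/-- The fraction of the proposition in terms of uniformly random best-response tables. -/
theorem superConnectedFraction_eq [NeZero k] :
    superConnectedFraction n k =
      pr (nashTables n k ∩ linkedTables n k) / pr (nashTables n k) := by
  let ω₀ : Line n k → Fin k := fun _ => 0
  have h1 := ncard_generic_eq (nashTables n k ∩ linkedTables n k) ω₀ {g | g.IsSuperConnected}
    fun g ω hg h => hg.isSuperConnected_iff h
  have h2 := ncard_generic_eq (nashTables n k) ω₀ {g | g.HasPureNash}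
    fun g ω hg h => hg.hasPureNash_iff h
  have hpos := genericNashGames_ncard_pos n (fun _ => k) (fun _ => NeZero.one_le)
  have e1 : genericSuperConnectedGames n (fun _ => k) =
    {g | g.IsGeneric ∧ g ∈ {g : Game n (fun _ => k) | g.IsSuperConnected}} := rfl
  have e2 : genericNashGames n (fun _ => k) =
    {g | g.IsGeneric ∧ g ∈ {g : Game n (fun _ => k) | g.HasPureNash}} := rfl
  unfold superConnectedFraction
  rw [e2, h2] at hpos
  rw [e1, e2, h1, h2]
  have hc : (0 : ℝ) < (gamesWith ω₀).ncard := by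
    exact_mod_cast pos_of_mul_pos_right hpos (Nat.zero_le _)
  have hN : (0 : ℝ) < Nat.card (Line n k → Fin k) := by exact_mod_cast Nat.card_pos
  unfold pr
  push_cast
  rw [mul_div_mul_right _ _ hc.ne', div_div_div_cancel_right₀ hN.ne']

end Reduction

/-! ### Independent events at the words of a code with one check symbol -/

section Codes

variable {n k : ℕ}

/-- The word `z` with a check symbol put in front of it: any two of these words differ in at least
two places. -/
def codeWord [NeZero k] (z : Fin n → Fin k) : Fin (n + 1) → Fin k :=
  Fin.cons (-∑ j, z j) z

/-- A lost letter is recovered from the check symbol and the other letters. Consequently no line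
contains two code words, which makes events at different code words independent. -/
theorem codeWord_injective_off [NeZero k] {z z' : Fin n → Fin k} {i : Fin (n + 1)}
    (h : ∀ j, j ≠ i → codeWord z j = codeWord z' j) : z = z' := by
  funext t
  by_cases ht : t.succ = i
  · subst ht
    have h0 : ∑ j, z j = ∑ j, z' j := by
      have := h 0 (Fin.succ_ne_zero t).symm
      simpa [codeWord] using this
    rw [Fintype.sum_eq_add_sum_compl t, Fintype.sum_eq_add_sum_compl t] at h0
    have h1 : ∑ j ∈ {t}ᶜ, z j = ∑ j ∈ {t}ᶜ, z' j := by
      refine Finset.sum_congr rfl fun j hj => ?_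
      have hj' : j ≠ t := by simpa using hj
      have := h j.succ (fun he => hj' (Fin.succ_injective _ he))
      simpa [codeWord] using this
    rw [h1] at h0
    exact add_right_cancel h0
  · have := h _ ht
    simpa [codeWord] using this

instance [NeZero k] : Nonempty (Line n k → Fin k) := ⟨fun _ => 0⟩

theorem depOn_forall {ι α J : Type*} (c : J → ι) (P : J → α → Prop) :
    DepOn {ω : ι → α | ∀ j, P j (ω (c j))} (Set.range c) := by
  intro ω ω' h hω j
  rw [← h (c j) ⟨j, rfl⟩]
  exact hω j

theorem one_sub_pow_le_exp {p : ℝ} (hp : p ≤ 1) (N : ℕ) :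
    (1 - p) ^ N ≤ Real.exp (-(N * p)) := by
  have h : 1 - p ≤ Real.exp (-p) := by linarith [Real.add_one_le_exp (-p)]
  calc (1 - p) ^ N ≤ Real.exp (-p) ^ N := pow_le_pow_left₀ (by linarith) h N
    _ = Real.exp (-(N * p)) := by rw [← Real.exp_nat_mul]; congr 1; ring

/-- A table has a pure Nash equilibrium with probability bounded away from zero. -/
theorem le_pr_nashTables [NeZero k] :
    1 - Real.exp (-(1 / k : ℝ)) ≤ pr (nashTables (n + 1) k) := by
  have hk : (0 : ℝ) < k := by exact_mod_cast NeZero.pos k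
  let E : (Fin n → Fin k) → Set (Line (n + 1) k → Fin k) := fun z =>
    {ω | ∀ i, ω (lineOf i (codeWord z)) = codeWord z i}
  let S : (Fin n → Fin k) → Set (Line (n + 1) k) := fun z =>
    Set.range fun i => lineOf i (codeWord z)
  have hinj : ∀ z : Fin n → Fin k, Function.Injective fun i => lineOf i (codeWord z) :=
    fun z i j h => (lineOf_eq_iff.1 h).1
  have hE : ∀ z, DepOn (E z) (S z) := fun z =>
    depOn_forall (fun i => lineOf i (codeWord z)) fun i y => y = codeWord z i
  have hS : Pairwise (Function.onFun Disjoint S) := by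
    intro z z' hz
    rw [Function.onFun, Set.disjoint_left]
    rintro _ ⟨i, rfl⟩ ⟨j, hj⟩
    exact hz (codeWord_injective_off (lineOf_eq_iff.1 hj).2).symm
  have hp : ∀ z, pr (E z) = (1 / k : ℝ) ^ (n + 1) := by
    intro z
    have := pr_forall_mem_of_injective (α := Fin k) (hinj z) fun i => {codeWord z i}
    simpa [E] using this
  have hsub : (nashTables (n + 1) k)ᶜ ⊆ ⋂ z, (E z)ᶜ := by
    intro ω hω
    simp only [Set.mem_iInter, Set.mem_compl_iff]
    exact fun z hz => hω ⟨codeWord z, hz⟩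
  have h1 := pr_mono hsub
  rw [pr_iInter (fun z => (hE z).compl) hS, pr_compl] at h1
  simp only [pr_compl, hp, Finset.prod_const, Finset.card_univ, Fintype.card_fun,
    Fintype.card_fin] at h1
  have h2 := one_sub_pow_le_exp (p := (1 / k : ℝ) ^ (n + 1))
    (pow_le_one₀ (by positivity) (by rw [div_le_one hk]; exact_mod_cast NeZero.one_le)) (k ^ n)
  -- The expected number of code words that are equilibria.
  have h3 : ((k ^ n : ℕ) : ℝ) * (1 / k : ℝ) ^ (n + 1) = 1 / k := by
    push_cast; rw [pow_succ, one_div, inv_pow]; field_simp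
  rw [h3] at h2
  linarith

theorem one_sub_exp_pos [NeZero k] : 0 < 1 - Real.exp (-(1 / k : ℝ)) := by
  have hk : (0 : ℝ) < k := by exact_mod_cast NeZero.pos k
  have : Real.exp (-(1 / k : ℝ)) < 1 := Real.exp_lt_one_iff.2 (by simpa using hk)
  linarith

/-! ### Four or more actions -/

/-- The tables in which every vertex of the line in direction `0` through `x` is hit from no other
direction. -/
def isolatedLine (x : Fin (n + 1) → Fin k) : Set (Line (n + 1) k → Fin k) :=
  {ω | ∀ c : Fin k × Fin n, ω (lineOf c.2.succ (Function.update x 0 c.1)) ≠ x c.2.succ}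

/-- Every move into the line starts on the line, so nothing outside reaches it. The best response on
the line is a non-source, and the parallel line through a changed coordinate `t.succ` contains a
non-sink. -/
theorem not_linked_of_isolatedLine (hk : 2 ≤ k) (hn : 1 ≤ n) {x : Fin (n + 1) → Fin k}
    {ω : Line (n + 1) k → Fin k} (hω : ω ∈ isolatedLine x) : ω ∉ linkedTables (n + 1) k := by
  intro hl
  have hk0 : NeZero k := ⟨by omega⟩
  have hk1 : Nontrivial (Fin k) := Fin.nontrivial_iff_two_le.2 hk
  have hne : ∀ u : Fin k, ∃ v, v ≠ u := fun u => exists_ne u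
  have hin : ∀ a b : Fin (n + 1) → Fin k, Move ω a b → (∀ j, j ≠ 0 → b j = x j) →
      (∀ j, j ≠ 0 → a j = x j) ∧ b = Function.update a 0 (ω (lineOf 0 a)) := by
    rintro a b ⟨i, rfl, hne⟩ hb
    have hi : i = 0 := by
      by_contra hi
      obtain ⟨t, rfl⟩ := Fin.exists_succ_eq.2 hi
      refine hω (a 0, t) ?_
      have h1 : lineOf t.succ (Function.update x 0 (a 0)) = lineOf t.succ a := by
        refine lineOf_eq_iff.2 ⟨rfl, fun j hj => ?_⟩
        by_cases hj0 : j = 0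
        · subst hj0; simp
        · rw [Function.update_of_ne hj0, ← hb j hj0, Function.update_of_ne hj]
      rw [h1]
      simpa using hb t.succ (Fin.succ_ne_zero t)
    subst hi
    exact ⟨fun j hj => by rw [← hb j hj, Function.update_of_ne hj], rfl⟩
  have hreach : ∀ a b : Fin (n + 1) → Fin k, Reach ω a b → (∀ j, j ≠ 0 → b j = x j) →
      (∀ j, j ≠ 0 → a j = x j) := by
    intro a b h
    induction h with
    | refl => exact id
    | tail _ h2 ih => exact fun hb => ih (hin _ _ h2 hb).1
  obtain ⟨u, hu⟩ := hne (ω (lineOf 0 x))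
  obtain ⟨t⟩ : Nonempty (Fin n) := ⟨⟨0, hn⟩⟩
  obtain ⟨v, hv⟩ := hne (x t.succ)
  obtain ⟨w, hw⟩ := hne (ω (lineOf 0 (Function.update x t.succ v)))
  have h := hl (Function.update (Function.update x t.succ v) 0 w)
    (Function.update x 0 (ω (lineOf 0 x))) ⟨_, 0, rfl, by simpa using hw⟩
    ⟨Function.update x 0 u, 0, by simp, by simpa using hu⟩
  have h2 := hreach _ _ h (fun j hj => by simp [hj]) t.succ (Fin.succ_ne_zero t)
  rw [Function.update_of_ne (Fin.succ_ne_zero t), Function.update_self] at h2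
  exact hv h2

/-- Each of the `k^n` candidate lines is isolated with probability `(1 - 1/k)^(k * (n + 1))`,
independently. Of the `n + 2` players one gives the direction of the line and one the check symbol.
-/
theorem pr_linkedTables_le (hk : 2 ≤ k) :
    pr (linkedTables (n + 1 + 1) k) ≤
      Real.exp (-(k ^ n * (1 - 1 / k : ℝ) ^ (k * (n + 1)))) := by
  have hk0 : NeZero k := ⟨by omega⟩
  have hkr : (0 : ℝ) < k := by exact_mod_cast NeZero.pos k
  let X : (Fin n → Fin k) → Fin (n + 1 + 1) → Fin k := fun z => Fin.cons 0 (codeWord z)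
  let c : (Fin n → Fin k) → Fin k × Fin (n + 1) → Line (n + 1 + 1) k := fun z p =>
    lineOf p.2.succ (Function.update (X z) 0 p.1)
  have hc : ∀ z z' p p', c z p = c z' p' → z = z' ∧ p = p' := by
    intro z z' p p' h
    obtain ⟨h1, h2⟩ := lineOf_eq_iff.1 h
    have h1' := Fin.succ_injective _ h1
    have h3 := h2 0 (Fin.succ_ne_zero _).symm
    simp only [Function.update_self] at h3
    refine ⟨codeWord_injective_off (i := p.2) fun j hj => ?_, Prod.ext h3 h1'⟩
    have := h2 j.succ (fun he => hj (Fin.succ_injective _ he))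
    simpa [X] using this
  let S : (Fin n → Fin k) → Set (Line (n + 1 + 1) k) := fun z => Set.range (c z)
  have hE : ∀ z, DepOn (isolatedLine (X z)) (S z) := fun z =>
    depOn_forall (c z) fun p y => y ≠ X z p.2.succ
  have hS : Pairwise (Function.onFun Disjoint S) := by
    intro z z' hz
    rw [Function.onFun, Set.disjoint_left]
    rintro _ ⟨i, rfl⟩ ⟨j, hj⟩
    exact hz (hc _ _ _ _ hj).1.symm
  have hp : ∀ z, pr (isolatedLine (X z)) = (1 - 1 / k : ℝ) ^ (k * (n + 1)) := by
    intro z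
    have := pr_forall_mem_of_injective (α := Fin k) (c := c z) (fun p p' h => (hc _ _ _ _ h).2)
      fun p => {X z p.2.succ}ᶜ
    have h2 : ((k - 1 : ℕ) : ℝ) / k = 1 - 1 / k := by
      rw [Nat.cast_sub (by omega)]; field_simp; simp
    simpa [isolatedLine, Finset.card_compl, c, h2] using this
  have hsub : linkedTables (n + 1 + 1) k ⊆ ⋂ z, (isolatedLine (X z))ᶜ := by
    intro ω hω
    simp only [Set.mem_iInter, Set.mem_compl_iff]
    exact fun z hz => not_linked_of_isolatedLine hk (by omega) hz hω
  have h1 := pr_mono hsub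
  rw [pr_iInter (fun z => (hE z).compl) hS] at h1
  simp only [pr_compl, hp, Finset.prod_const, Finset.card_univ, Fintype.card_fun,
    Fintype.card_fin] at h1
  have h0 : (0 : ℝ) ≤ 1 - 1 / k := by
    rw [sub_nonneg, div_le_one hkr]; exact_mod_cast NeZero.one_le
  have h2 := one_sub_pow_le_exp (p := (1 - 1 / k : ℝ) ^ (k * (n + 1)))
    (pow_le_one₀ h0 (by linarith [show (0 : ℝ) ≤ 1 / k by positivity])) (k ^ n)
  push_cast at h2
  exact h1.trans h2

/-- The value at 4 is 81/64. For `k ≥ 5`, Bernoulli's inequality for the exponent `k / 2`, squared,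
gives `(1 - 1/k)^k ≥ 1/4`. -/
theorem one_lt_mul_one_sub_pow (hk : 4 ≤ k) : 1 < (k : ℝ) * (1 - 1 / k) ^ k := by
  have hk' : (4 : ℝ) ≤ k := by exact_mod_cast hk
  rcases eq_or_lt_of_le hk with rfl | h5
  · norm_num
  have h5' : (5 : ℝ) ≤ k := by exact_mod_cast h5
  obtain ⟨m, hm | hm⟩ := Nat.even_or_odd' k
  · have hb := one_add_mul_le_pow (a := -(1 / k : ℝ)) (by
      have : (1 / k : ℝ) ≤ 1 := by rw [div_le_one] <;> linarith
      linarith) m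
    have hmk : (m : ℝ) = k / 2 := by rw [hm]; push_cast; ring
    have h1 : (1 : ℝ) / 2 ≤ (1 - 1 / k) ^ m := by
      refine le_trans (le_of_eq ?_) (hb.trans_eq (by rw [sub_eq_add_neg]))
      rw [hmk]; field_simp; norm_num
    have h2 : (1 - 1 / k : ℝ) ^ k = ((1 - 1 / k) ^ m) ^ 2 := by
      rw [← pow_mul]; congr 1; omega
    rw [h2]
    nlinarith
  · have hb := one_add_mul_le_pow (a := -(1 / k : ℝ)) (by
      have : (1 / k : ℝ) ≤ 1 := by rw [div_le_one] <;> linarith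
      linarith) m
    have hmk : (m : ℝ) = (k - 1) / 2 := by rw [hm]; push_cast; ring
    have h1 : (1 : ℝ) / 2 * (1 + 1 / k) ≤ (1 - 1 / k) ^ m := by
      refine le_trans (le_of_eq ?_) (hb.trans_eq (by rw [sub_eq_add_neg]))
      rw [hmk]; field_simp; ring
    have h2 : (1 - 1 / k : ℝ) ^ k = ((1 - 1 / k) ^ m) ^ 2 * (1 - 1 / k) := by
      rw [← pow_mul, ← pow_succ]; congr 1; omega
    rw [h2]
    have hx : (1 : ℝ) / k ≤ 1 / 5 := by gcongr
    have hx0 : (0 : ℝ) < 1 / k := by positivity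
    set x : ℝ := 1 / k with hxdef
    have h3 : (1 / 2 * (1 + x)) ^ 2 ≤ ((1 - x) ^ m) ^ 2 := by gcongr
    have h4 : (1 / 2 * (1 + x)) ^ 2 * (1 - x) ≤ ((1 - x) ^ m) ^ 2 * (1 - x) := by
      gcongr; linarith
    have h5 : (1 : ℝ) / 4 ≤ (1 / 2 * (1 + x)) ^ 2 * (1 - x) := by
      have h6 : 0 ≤ x * (1 - x - x ^ 2) := mul_nonneg hx0.le (by nlinarith)
      nlinarith
    nlinarith

/-- With at least four actions, super-connectedness is asymptotically unlikely. -/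
theorem tendsto_superConnectedFraction (hk : 4 ≤ k) :
    Tendsto (fun n : ℕ => superConnectedFraction n k) atTop (𝓝 0) := by
  have hk0 : NeZero k := ⟨by omega⟩
  have hkr : (0 : ℝ) < k := by exact_mod_cast NeZero.pos k
  rw [← tendsto_add_atTop_iff_nat 2]
  set r : ℝ := k * (1 - 1 / k) ^ k with hr
  have hr1 : 1 < r := one_lt_mul_one_sub_pow hk
  set δ : ℝ := 1 - Real.exp (-(1 / k : ℝ)) with hδ
  have hδ0 : 0 < δ := one_sub_exp_pos
  set q : ℝ := (1 - 1 / k : ℝ) ^ k with hq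
  have hq0 : 0 < q := by
    by_contra h
    have := mul_nonpos_of_nonneg_of_nonpos hkr.le (not_lt.1 h)
    linarith
  have hlim : Tendsto (fun n : ℕ => Real.exp (-(r ^ n * q)) / δ) atTop (𝓝 0) := by
    have h1 : Tendsto (fun n : ℕ => r ^ n * q) atTop atTop :=
      (tendsto_pow_atTop_atTop_of_one_lt hr1).atTop_mul_const hq0
    have h2 := (Real.tendsto_exp_neg_atTop_nhds_zero.comp h1).div_const δ
    simpa using h2
  refine squeeze_zero (fun n => ?_) (fun n => ?_) hlim
  · unfold superConnectedFraction; positivity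
  · rw [superConnectedFraction_eq]
    have h1 : pr (nashTables (n + 2) k ∩ linkedTables (n + 2) k) ≤ Real.exp (-(r ^ n * q)) := by
      refine (pr_mono Set.inter_subset_right).trans
        ((pr_linkedTables_le (n := n) (by omega)).trans (le_of_eq ?_))
      rw [hr, mul_pow, pow_mul, ← hq]; ring_nf
    exact div_le_div₀ (Real.exp_pos _).le h1 hδ0 le_pr_nashTables

end Codes

/-! ### Greedy paths -/

section Greedy

variable {n k : ℕ}

/-- The lines in a direction in which `x` and `y` differ, through a point of the box spanned by
`x` and `y`. -/
def boxLines (x y : Fin n → Fin k) : Set (Line n k) :=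
  {l | ∃ v i, l = lineOf i v ∧ x i ≠ y i ∧ ∀ j, v j = x j ∨ v j = y j}

/-- A greedy path from `x` to `y` exists with a probability that depends only on their Hamming
distance, and it is found by looking at the lines in `boxLines x y` only. -/
theorem exists_greedy_event [NeZero k] (d : ℕ) : ∀ x y : Fin n → Fin k,
    (Finset.univ.filter fun i => x i ≠ y i).card = d →
    ∃ E : Set (Line n k → Fin k), DepOn E (boxLines x y) ∧ (∀ ω ∈ E, Reach ω x y) ∧
      ∏ m ∈ Finset.range d, (1 - (1 - 1 / k : ℝ) ^ (m + 1)) ≤ pr E := by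
  classical
  have hkr : (0 : ℝ) < k := by exact_mod_cast NeZero.pos k
  have hk1 : 1 ≤ k := NeZero.one_le
  induction d with
  | zero =>
    intro x y h
    have hxy : x = y := by
      funext i
      by_contra hi
      have : i ∈ (Finset.univ.filter fun i => x i ≠ y i) := by simpa using hi
      rw [Finset.card_eq_zero.1 h] at this
      simp at this
    subst hxy
    exact ⟨Set.univ, fun _ _ _ _ => trivial, fun _ _ => Relation.ReflTransGen.refl,
      by simp [pr_univ]⟩
  | succ d ih =>
    intro x y h
    set D := Finset.univ.filter fun i => x i ≠ y i with hD
    have hmemD : ∀ i, i ∈ D ↔ x i ≠ y i := fun i => by simp [hD]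
    -- The directions in which a best response at `x` brings it one step closer to `y`; the path
    -- continues in one of them if there is any, which has probability `1 - (1 - 1/k)^(d + 1)`.
    let Z : (Line n k → Fin k) → Finset (Fin n) := fun ω => D.filter fun i => ω (lineOf i x) = y i
    let S₀ : Set (Line n k) := {l | ∃ i ∈ D, l = lineOf i x}
    have hZ : ∀ ω ω' : Line n k → Fin k, (∀ l ∈ S₀, ω l = ω' l) → Z ω = Z ω' := by
      intro ω ω' hω
      refine Finset.filter_congr fun i hi => ?_
      rw [hω _ ⟨i, hi, rfl⟩]
    have hex : ∀ i ∈ D, ∃ E : Set (Line n k → Fin k),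
        DepOn E (boxLines (Function.update x i (y i)) y) ∧
        (∀ ω ∈ E, Reach ω (Function.update x i (y i)) y) ∧
        ∏ m ∈ Finset.range d, (1 - (1 - 1 / k : ℝ) ^ (m + 1)) ≤ pr E := by
      intro i hi
      apply ih
      have : (Finset.univ.filter fun j => Function.update x i (y i) j ≠ y j) = D.erase i := by
        ext j
        by_cases hj : j = i
        · subst hj; simp
        · simp [hj, hmemD]
      rw [this, Finset.card_erase_of_mem hi, h]
      rfl
    choose! E hE1 hE2 hE3 using hex
    let B : Set (Finset (Fin n)) := {z | z ⊆ D ∧ z.Nonempty}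
    have hpick : ∀ z : Finset (Fin n), ∃ i, z ∈ B → i ∈ z := by
      intro z
      by_cases hz : z ∈ B
      · exact ⟨hz.2.choose, fun _ => hz.2.choose_spec⟩
      · have hD0 : 0 < D.card := by omega
        exact ⟨(Finset.card_pos.1 hD0).choose, fun h => absurd h hz⟩
    choose pick hpick using hpick
    have hpickD : ∀ z ∈ B, pick z ∈ D := fun z hz => hz.1 (hpick z hz)
    have hsub : ∀ i ∈ D, boxLines (Function.update x i (y i)) y ⊆ boxLines x y := by
      rintro i hi _ ⟨v, j, rfl, hj, hv⟩
      have hji : j ≠ i := by rintro rfl; simp at hj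
      refine ⟨v, j, rfl, by simpa [hji] using hj, fun t => ?_⟩
      by_cases ht : t = i
      · subst ht; exact Or.inr (by simpa using hv t)
      · simpa [ht] using hv t
    refine ⟨{ω | Z ω ∈ B ∧ ω ∈ E (pick (Z ω))}, ?_, ?_, ?_⟩
    · rintro ω ω' hω ⟨h1, h2⟩
      have hZZ : Z ω = Z ω' := hZ ω ω' (by
        rintro _ ⟨i, hi, rfl⟩
        exact hω _ ⟨x, i, rfl, (hmemD i).1 hi, fun _ => Or.inl rfl⟩)
      refine ⟨hZZ ▸ h1, ?_⟩
      rw [← hZZ]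
      exact hE1 _ (hpickD _ h1) ω ω' (fun l hl => hω l (hsub _ (hpickD _ h1) hl)) h2
    · rintro ω ⟨h1, h2⟩
      have h3 := hpick _ h1
      have h4 : ω (lineOf (pick (Z ω)) x) = y (pick (Z ω)) := (Finset.mem_filter.1 h3).2
      refine Relation.ReflTransGen.head ⟨pick (Z ω), rfl, ?_⟩ ?_
      · rw [h4]; exact (hmemD _).1 (hpickD _ h1)
      · rw [h4]; exact hE2 _ (hpickD _ h1) ω h2
    · have hc := le_pr_of_cond hZ (B := B) (E := fun z => E (pick z))
        (S := fun z => boxLines (Function.update x (pick z) (y (pick z))) y)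
        (fun z hz => hE1 _ (hpickD z hz)) (fun z hz => ?_) (fun z hz => hE3 _ (hpickD z hz))
      · refine le_trans (le_of_eq ?_) hc
        rw [Finset.prod_range_succ, mul_comm]
        congr 1
        have hcompl : (Z ⁻¹' B)ᶜ = {ω | ∀ j : D, ω (lineOf (j : Fin n) x) ∈
            ({y j}ᶜ : Finset (Fin k))} := by
          ext ω
          simp only [Set.mem_compl_iff, Set.mem_preimage, Set.mem_ofPred_eq, Finset.mem_compl,
            Finset.mem_singleton, B, Z]
          constructor
          · intro hn j hj
            exact hn ⟨Finset.filter_subset _ _, j, Finset.mem_filter.2 ⟨j.2, hj⟩⟩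
          · rintro hn ⟨-, j, hj⟩
            exact hn ⟨j, (Finset.mem_filter.1 hj).1⟩ (Finset.mem_filter.1 hj).2
        have hp := pr_forall_mem_of_injective (α := Fin k) (c := fun j : D => lineOf (j : Fin n) x)
          (fun i j hij => Subtype.ext (lineOf_eq_iff.1 hij).1) fun j => {y j}ᶜ
        rw [← hcompl, pr_compl] at hp
        have h2 : ((k - 1 : ℕ) : ℝ) / k = 1 - 1 / k := by
          rw [Nat.cast_sub hk1]; field_simp; simp
        simp only [Finset.card_compl, Finset.card_singleton, Fintype.card_fin, h2,
          Finset.prod_const, Finset.card_univ, Fintype.card_coe, h] at hp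
        linarith
      -- Later lines have coordinate `y` in the direction just taken, those inspected at `x` in
      -- other directions have coordinate `x` there; so no line is inspected twice.
      · rw [Set.disjoint_left]
        rintro _ ⟨i, hi, rfl⟩ ⟨v, j, hl, hj, hv⟩
        obtain ⟨rfl, h2⟩ := lineOf_eq_iff.1 hl
        have hji : i ≠ pick z := by intro hh; rw [← hh] at hj; simp at hj
        have h3 := h2 _ hji.symm
        have h4 := hv (pick z)
        simp only [Function.update_self, or_self] at h4
        exact (hmemD _).1 (hpickD z hz) (h3.trans h4)

/-- For `u = q^(m+1) ≤ 1 - 1/k` one has `1 - u ≥ exp (-k u)`, and the geometric series of the `u` is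
at most `k`. -/
theorem exp_le_prod_one_sub_pow [NeZero k] (d : ℕ) :
    Real.exp (-(k ^ 2 : ℝ)) ≤ ∏ m ∈ Finset.range d, (1 - (1 - 1 / k : ℝ) ^ (m + 1)) := by
  have hkr : (0 : ℝ) < k := by exact_mod_cast NeZero.pos k
  have hk1 : (1 : ℝ) ≤ k := by exact_mod_cast NeZero.one_le (n := k)
  set q : ℝ := 1 - 1 / k with hq
  have hq0 : 0 ≤ q := by rw [hq, sub_nonneg, div_le_one hkr]; exact hk1
  have hq1 : q < 1 := by rw [hq]; have : 0 < 1 / (k : ℝ) := by positivity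
                         linarith
  have hterm : ∀ m : ℕ, Real.exp (-(k * q ^ (m + 1))) ≤ 1 - q ^ (m + 1) := by
    intro m
    set u := q ^ (m + 1)
    have hu0 : 0 ≤ u := by positivity
    have huq : u ≤ q := pow_le_of_le_one hq0 hq1.le (Nat.succ_ne_zero m)
    have h1u : 1 / (k : ℝ) ≤ 1 - u := by linarith
    have h1u0 : 0 < 1 - u := lt_of_lt_of_le (by positivity) h1u
    have hk2 : 1 ≤ k * (1 - u) := by rw [div_le_iff₀ hkr] at h1u; linarith
    rw [Real.exp_neg, inv_le_comm₀ (Real.exp_pos _) h1u0]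
    refine le_trans ?_ (Real.add_one_le_exp _)
    rw [inv_le_iff_one_le_mul₀ h1u0]
    nlinarith
  calc Real.exp (-(k ^ 2 : ℝ)) ≤ Real.exp (∑ m ∈ Finset.range d, -(k * q ^ (m + 1))) := by
        apply Real.exp_le_exp.2
        rw [Finset.sum_neg_distrib, neg_le_neg_iff, ← Finset.mul_sum, sq]
        refine mul_le_mul_of_nonneg_left ?_ hkr.le
        have h1 : ∑ m ∈ Finset.range d, q ^ (m + 1) ≤ ∑ m ∈ Finset.range d, q ^ m :=
          Finset.sum_le_sum fun m _ => pow_le_pow_of_le_one hq0 hq1.le (Nat.le_succ m)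
        have h2 : (∑ m ∈ Finset.range d, q ^ m) * (1 - q) = 1 - q ^ d := by
          linarith [geom_sum_mul q d]
        have h3 : 1 - q = 1 / k := by rw [hq]; ring
        rw [h3, mul_one_div, div_eq_iff hkr.ne'] at h2
        have h4 : (0 : ℝ) ≤ q ^ d := by positivity
        nlinarith
    _ = ∏ m ∈ Finset.range d, Real.exp (-(k * q ^ (m + 1))) := Real.exp_sum _ _
    _ ≤ _ := Finset.prod_le_prod (fun _ _ => (Real.exp_pos _).le) fun m _ => hterm m

/-- Any two profiles are joined by a path with probability bounded away from zero. -/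
theorem exists_path_event [NeZero k] (x y : Fin n → Fin k) :
    ∃ E : Set (Line n k → Fin k), DepOn E (boxLines x y) ∧ (∀ ω ∈ E, Reach ω x y) ∧
      Real.exp (-(k ^ 2 : ℝ)) ≤ pr E := by
  obtain ⟨E, h1, h2, h3⟩ := exists_greedy_event _ x y rfl
  exact ⟨E, h1, h2, (exp_le_prod_one_sub_pow _).trans h3⟩

end Greedy

/-! ### Vertices of small degree -/

section Degrees

variable {n k : ℕ}

/-- The directions in `K` in which the best response at `v` violates the constraint `B`. -/
def missDirs (B : Fin k → Finset (Fin k)) (K : Finset (Fin n)) (ω : Line n k → Fin k)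
    (v : Fin n → Fin k) : Finset (Fin n) :=
  K.filter fun i => ω (lineOf i v) ∉ B (v i)

theorem mem_missDirs {B : Fin k → Finset (Fin k)} {K : Finset (Fin n)} {ω : Line n k → Fin k}
    {v : Fin n → Fin k} {i : Fin n} :
    i ∈ missDirs B K ω v ↔ i ∈ K ∧ ω (lineOf i v) ∉ B (v i) := Finset.mem_filter

/-- Constraints at the vertices of a common line are negatively correlated. -/
theorem pr_forall_pairs_le [NeZero k] {B : Fin k → Finset (Fin k)} {β : ℝ}
    (hB : ∀ C : Finset (Fin k),
      ((Finset.univ.filter fun y => ∀ x ∈ C, y ∈ B x).card : ℝ) ≤ k * β ^ C.card)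
    (T : Finset ((Fin n → Fin k) × Fin n)) :
    pr {ω : Line n k → Fin k | ∀ p ∈ T, ω (lineOf p.2 p.1) ∈ B (p.1 p.2)} ≤ β ^ T.card := by
  classical
  have hkr : (0 : ℝ) < k := by exact_mod_cast NeZero.pos k
  -- All pairs of `T` on one line constrain the same entry; `hB` charges a factor `β` for each of
  -- them, as if they were independent.
  let C : Line n k → Finset (Fin k) := fun l =>
    (T.filter fun p => lineOf p.2 p.1 = l).image fun p => p.1 p.2
  let A : Line n k → Finset (Fin k) := fun l => Finset.univ.filter fun y => ∀ x ∈ C l, y ∈ B x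
  have hC : ∀ l, (C l).card = (T.filter fun p => lineOf p.2 p.1 = l).card := by
    intro l
    refine Finset.card_image_of_injOn ?_
    rintro ⟨v, i⟩ hp ⟨v', i'⟩ hp' h
    simp only [Finset.coe_filter, Set.mem_ofPred_eq] at hp hp'
    obtain ⟨rfl, h2⟩ := lineOf_eq_iff.1 (hp.2.trans hp'.2.symm)
    simp only at h h2
    congr 1
    funext j
    by_cases hj : j = i
    · subst hj; exact h
    · exact h2 j hj
  have hev : {ω : Line n k → Fin k | ∀ p ∈ T, ω (lineOf p.2 p.1) ∈ B (p.1 p.2)} =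
      {ω | ∀ l, ω l ∈ A l} := by
    ext ω
    simp only [Set.mem_ofPred_eq, A, C, Finset.mem_filter, Finset.mem_univ, true_and,
      Finset.mem_image]
    constructor
    · rintro h l x ⟨p, ⟨hp, rfl⟩, rfl⟩; exact h p hp
    · intro h p hp; exact h _ _ ⟨p, ⟨hp, rfl⟩, rfl⟩
  rw [hev, pr_forall_mem]
  calc ∏ l, ((A l).card / Fintype.card (Fin k) : ℝ) ≤ ∏ l, β ^ (C l).card := by
        refine Finset.prod_le_prod (fun _ _ => by positivity) fun l _ => ?_
        rw [Fintype.card_fin, div_le_iff₀' hkr]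
        exact hB (C l)
    _ = β ^ T.card := by
        rw [Finset.prod_pow_eq_pow_sum, Finset.card_eq_sum_card_fiberwise
          (f := fun p : (Fin n → Fin k) × Fin n => lineOf p.2 p.1) (t := Finset.univ)
          (fun _ _ => by simp)]
        simp only [hC]

/-- Distinct vertices rarely all have few missed directions. -/
theorem pr_forall_card_missDirs_le [NeZero k] {B : Fin k → Finset (Fin k)} {β la : ℝ} (hβ : 0 ≤ β)
    (hla : 0 < la) (hla1 : la ≤ 1)
    (hB : ∀ C : Finset (Fin k),
      ((Finset.univ.filter fun y => ∀ x ∈ C, y ∈ B x).card : ℝ) ≤ k * β ^ C.card)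
    (K : Finset (Fin n)) (h : ℕ) {R : ℕ} {v : Fin R → Fin n → Fin k} (hv : Function.Injective v) :
    pr {ω : Line n k → Fin k | ∀ r, (missDirs B K ω (v r)).card ≤ h} ≤
      ((β + la) ^ K.card * la⁻¹ ^ h) ^ R := by
  classical
  let P : Finset (Finset (Fin n)) := K.powerset.filter fun U => K.card - U.card ≤ h
  let T : (Fin R → Finset (Fin n)) → Finset ((Fin n → Fin k) × Fin n) := fun U =>
    (Finset.univ.sigma fun r => U r).image fun p => (v p.1, p.2)
  have hT : ∀ U, (T U).card = ∑ r, (U r).card := by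
    intro U
    rw [Finset.card_image_of_injective, Finset.card_sigma]
    rintro ⟨r, i⟩ ⟨r', i'⟩ hh
    simp only [Prod.mk.injEq] at hh
    obtain rfl := hv hh.1
    obtain rfl := hh.2
    rfl
  have hsub : {ω : Line n k → Fin k | ∀ r, (missDirs B K ω (v r)).card ≤ h} ⊆
      ⋃ U ∈ Fintype.piFinset fun _ : Fin R => P,
        {ω | ∀ p ∈ T U, ω (lineOf p.2 p.1) ∈ B (p.1 p.2)} := by
    intro ω hω
    refine Set.mem_iUnion₂.2 ⟨fun r => K \ missDirs B K ω (v r), ?_, ?_⟩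
    · rw [Fintype.mem_piFinset]
      intro r
      refine Finset.mem_filter.2 ⟨Finset.mem_powerset.2 Finset.sdiff_subset, ?_⟩
      have hle : missDirs B K ω (v r) ⊆ K := Finset.filter_subset _ _
      rw [Finset.card_sdiff_of_subset hle]
      have h1 := hω r
      omega
    · intro p hp
      obtain ⟨⟨r, i⟩, hri, rfl⟩ := Finset.mem_image.1 hp
      have h1 := (Finset.mem_sigma.1 hri).2
      simp only [Finset.mem_sdiff, mem_missDirs, not_and, not_not] at h1
      exact h1.2 h1.1
  calc _ ≤ ∑ U ∈ Fintype.piFinset fun _ : Fin R => P, β ^ (T U).card :=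
        (pr_mono hsub).trans ((pr_biUnion_le _ _).trans
          (Finset.sum_le_sum fun U _ => pr_forall_pairs_le hB (T U)))
    _ = ∑ U ∈ Fintype.piFinset fun _ : Fin R => P, ∏ r, β ^ (U r).card := by
        simp only [hT, Finset.prod_pow_eq_pow_sum]
    _ = (∑ U ∈ P, β ^ U.card) ^ R := by
        have := Finset.prod_univ_sum (fun _ : Fin R => P) (fun _ U => β ^ U.card)
        simpa using this.symm
    _ ≤ _ := by
        refine pow_le_pow_left₀ (Finset.sum_nonneg fun _ _ => by positivity) ?_ R
        -- As in Chernoff's bound: a set `U` that omits at most `h` directions has weight at least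
        -- `la^h` in the binomial expansion of `(β + la)^|K|`.
        rw [← Finset.sum_pow_mul_eq_add_pow, Finset.sum_mul]
        refine (Finset.sum_le_sum (f := fun U : Finset (Fin n) => β ^ U.card) (s := P)
          fun U hU => ?_).trans
          (Finset.sum_le_sum_of_subset_of_nonneg (Finset.filter_subset _ _)
            fun _ _ _ => by positivity)
        rw [mul_assoc]
        refine le_mul_of_one_le_right (by positivity) ?_
        rw [inv_pow, ← div_eq_mul_inv, one_le_div (by positivity)]
        exact pow_le_pow_of_le_one hla.le hla1 (Finset.mem_filter.1 hU).2

/-- Among any `R` distinct vertices in a ball of radius one, some vertex has more than `h` missed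
directions. -/
def Spread (R : ℕ) (B : Fin k → Finset (Fin k)) (K : Finset (Fin n)) (h : ℕ)
    (ω : Line n k → Fin k) : Prop :=
  ∀ (c : Fin n → Fin k) (e : Fin R → Fin n × Fin k),
    Function.Injective (fun r => Function.update c (e r).1 (e r).2) →
    ∃ r, h < (missDirs B K ω (Function.update c (e r).1 (e r).2)).card

/-- A union bound over the centre and the `R` vertices. It is used twice. For `B x = {x}` the missed
directions are those of outgoing moves, `β = 1/k` and `R = 2`. For `B x = {x}ᶜ` they are those from
which the vertex is entered, `β = 1 - 1/k` and `R = k`. The essential condition is `k * β^R < 1`,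
which in the second case forces `k ≤ 3`. -/
theorem pr_not_spread_le [NeZero k] {B : Fin k → Finset (Fin k)} {β la : ℝ} (hβ : 0 ≤ β)
    (hla : 0 < la) (hla1 : la ≤ 1)
    (hB : ∀ C : Finset (Fin k),
      ((Finset.univ.filter fun y => ∀ x ∈ C, y ∈ B x).card : ℝ) ≤ k * β ^ C.card)
    (K : Finset (Fin n)) (h R : ℕ) :
    pr {ω : Line n k → Fin k | ¬ Spread R B K h ω} ≤
      (k ^ n * (n * k) ^ R : ℝ) * ((β + la) ^ K.card * la⁻¹ ^ h) ^ R := by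
  classical
  have hsub : {ω : Line n k → Fin k | ¬ Spread R B K h ω} ⊆
      ⋃ p : (Fin n → Fin k) × (Fin R → Fin n × Fin k),
        {ω | Function.Injective (fun r => Function.update p.1 (p.2 r).1 (p.2 r).2) ∧ ∀ r,
          (missDirs B K ω (Function.update p.1 (p.2 r).1 (p.2 r).2)).card ≤ h} := by
    intro ω hω
    simp only [Set.mem_ofPred_eq, Spread, not_forall, not_exists, not_lt] at hω
    obtain ⟨c, e, h1, h2⟩ := hω
    exact Set.mem_iUnion.2 ⟨(c, e), h1, h2⟩
  refine (pr_mono hsub).trans ((pr_iUnion_le _).trans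
    ((Finset.sum_le_card_nsmul _ _ (((β + la) ^ K.card * la⁻¹ ^ h) ^ R) fun p _ => ?_).trans
      (le_of_eq ?_)))
  · by_cases hp : Function.Injective (fun r => Function.update p.1 (p.2 r).1 (p.2 r).2)
    · exact (pr_mono fun ω hω => hω.2).trans
        (pr_forall_card_missDirs_le hβ hla hla1 hB K h hp)
    · simp only [hp, false_and, Set.ofPred_false, pr_empty]
      positivity
  · simp [Fintype.card_prod, nsmul_eq_mul]

/-- Neighbours of `c` in different directions are distinct, so `R` poor ones would contradict
`Spread`. -/
theorem Spread.card_filter_lt {R : ℕ} {B : Fin k → Finset (Fin k)} {K : Finset (Fin n)} {h : ℕ}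
    {ω : Line n k → Fin k} (hs : Spread R B K h ω) (c x : Fin n → Fin k) (W : Finset (Fin n))
    (hx : ∀ s ∈ W, x s ≠ c s) :
    (W.filter fun s => (missDirs B K ω (Function.update c s (x s))).card ≤ h).card < R := by
  by_contra hR
  let f := Finset.orderEmbOfCardLe _ (not_lt.1 hR)
  have hf : ∀ r, f r ∈ W.filter fun s => (missDirs B K ω (Function.update c s (x s))).card ≤ h :=
    fun r => Finset.orderEmbOfCardLe_mem _ _ r
  obtain ⟨r, hr⟩ := hs c (fun r => (f r, x (f r))) (by
    intro r r' hrr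
    by_contra hne
    have hne' : f r ≠ f r' := fun h => hne (f.injective h)
    have := congrFun hrr (f r)
    simp only [Function.update_self, Function.update_of_ne hne'] at this
    exact hx _ (Finset.mem_filter.1 (hf r)).1 this)
  exact absurd (Finset.mem_filter.1 (hf r)).2 (not_le.2 hr)

/-! ### Second neighbourhoods -/

/-- The vertices obtained from `c` by two moves `F s`, each in an admissible direction. -/
def secondNbrs (D : (Fin n → Fin k) → Finset (Fin n))
    (F : Fin n → (Fin n → Fin k) → (Fin n → Fin k)) (c : Fin n → Fin k) :
    Finset (Fin n → Fin k) :=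
  (D c).biUnion fun s => (D (F s c)).image fun s' => F s' (F s c)

theorem mem_secondNbrs {D : (Fin n → Fin k) → Finset (Fin n)}
    {F : Fin n → (Fin n → Fin k) → (Fin n → Fin k)} {c x : Fin n → Fin k} :
    x ∈ secondNbrs D F c ↔ ∃ s ∈ D c, ∃ s' ∈ D (F s c), F s' (F s c) = x := by
  simp [secondNbrs]

/-- Both moves stay among the vertices that agree with `c` off `K`, so only the data there matter.
This locality later permits conditioning on the neighbourhoods. -/
theorem secondNbrs_congr {D D' : (Fin n → Fin k) → Finset (Fin n)}
    {F F' : Fin n → (Fin n → Fin k) → (Fin n → Fin k)} {c : Fin n → Fin k} {K : Finset (Fin n)}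
    (hD : ∀ v, (∀ j, j ∉ K → v j = c j) → D v = D' v)
    (hF : ∀ s ∈ K, ∀ v, (∀ j, j ∉ K → v j = c j) → F s v = F' s v)
    (hK : ∀ v, D v ⊆ K) (hFK : ∀ s v j, j ≠ s → F s v j = v j) :
    secondNbrs D F c = secondNbrs D' F' c := by
  have hstep : ∀ s ∈ D c, ∀ j, j ∉ K → F s c j = c j := fun s hs j hj =>
    hFK s c j (by rintro rfl; exact hj (hK c hs))
  ext x
  rw [mem_secondNbrs, mem_secondNbrs, ← hD c fun _ _ => rfl]
  refine exists_congr fun s => and_congr_right fun hs => ?_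
  rw [← hF s (hK c hs) c fun _ _ => rfl, ← hD _ (hstep s hs)]
  refine exists_congr fun s' => and_congr_right fun hs' => ?_
  rw [← hF s' (hK _ hs') _ (hstep s hs)]

/-- Of at least `h + 1` first moves at most `R - 1` end at a poor vertex; each of the other `h + 2 -
R` continues in more than `h` ways. By `hs` the two directions differ, hence they are exactly the
coordinates changed, and at most four ordered pairs give the same endpoint. -/
theorem card_secondNbrs {D : (Fin n → Fin k) → Finset (Fin n)}
    {F : Fin n → (Fin n → Fin k) → (Fin n → Fin k)} {c : Fin n → Fin k} {h R : ℕ}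
    (hF : ∀ s v, s ∈ D v → F s v s ≠ v s) (hFK : ∀ s v j, j ≠ s → F s v j = v j)
    (hs : ∀ s v, s ∈ D v → s ∉ D (F s v)) (hc : h < (D c).card)
    (hbad : ((D c).filter fun s => (D (F s c)).card ≤ h).card < R) :
    (h + 2 - R) * h ≤ 4 * (secondNbrs D F c).card := by
  classical
  let W := (D c).filter fun s => h < (D (F s c)).card
  have hW : h + 2 - R ≤ W.card := by
    have := Finset.card_filter_add_card_filter_not (s := D c) (fun s => h < (D (F s c)).card)
    simp only [not_lt] at this
    change W.card + _ = _ at this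
    omega
  let P : Finset (Σ _ : Fin n, Fin n) := W.sigma fun s => D (F s c)
  have hP : (h + 2 - R) * h ≤ P.card := by
    rw [Finset.card_sigma]
    calc (h + 2 - R) * h ≤ W.card * h := Nat.mul_le_mul_right _ hW
      _ = ∑ _s ∈ W, h := by simp
      _ ≤ _ := Finset.sum_le_sum fun s hs => (Finset.mem_filter.1 hs).2.le
  let Φ : (Σ _ : Fin n, Fin n) → (Fin n → Fin k) := fun p => F p.2 (F p.1 c)
  have himg : P.image Φ ⊆ secondNbrs D F c := by
    intro x hx
    obtain ⟨⟨s, s'⟩, hp, rfl⟩ := Finset.mem_image.1 hx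
    obtain ⟨h1, h2⟩ := Finset.mem_sigma.1 hp
    exact mem_secondNbrs.2 ⟨s, (Finset.mem_filter.1 h1).1, s', h2, rfl⟩
  refine hP.trans ((Finset.card_le_mul_card_image P 4 (f := Φ) fun x hx => ?_).trans
    (Nat.mul_le_mul_left 4 (Finset.card_le_card himg)))
  let Δ := Finset.univ.filter fun i => x i ≠ c i
  have hΔ : ∀ p ∈ P, Φ p = x → p.1 ∈ Δ ∧ p.2 ∈ Δ ∧ Δ ⊆ {p.1, p.2} := by
    rintro ⟨s, s'⟩ hp rfl
    obtain ⟨h1, h2⟩ := Finset.mem_sigma.1 hp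
    have h1' := (Finset.mem_filter.1 h1).1
    have hne : s ≠ s' := by rintro rfl; exact hs s c h1' h2
    refine ⟨?_, ?_, ?_⟩
    · simp only [Δ, Φ, Finset.mem_filter, Finset.mem_univ, true_and]
      rw [hFK s' _ s hne]
      exact hF s c h1'
    · simp only [Δ, Φ, Finset.mem_filter, Finset.mem_univ, true_and]
      rw [← hFK s c s' hne.symm]
      exact hF s' _ h2
    · intro i hi
      simp only [Δ, Φ, Finset.mem_filter, Finset.mem_univ, true_and] at hi
      by_contra hi'
      simp only [Finset.mem_insert, Finset.mem_singleton, not_or] at hi'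
      exact hi (by rw [hFK s' _ i hi'.2, hFK s _ i hi'.1])
  obtain ⟨p₀, hp₀, hp₀x⟩ := Finset.mem_image.1 hx
  have hΔ2 : Δ.card ≤ 2 := (Finset.card_le_card (hΔ p₀ hp₀ hp₀x).2.2).trans Finset.card_le_two
  calc (P.filter fun p => Φ p = x).card ≤ (Δ ×ˢ Δ).card := by
        refine Finset.card_le_card_of_injOn (fun p => (p.1, p.2)) ?_ ?_
        · intro p hp
          have hp' : p ∈ P ∧ Φ p = x := by simpa using hp
          have := hΔ p hp'.1 hp'.2
          simp only [Finset.coe_product, Set.mem_prod, Finset.mem_coe]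
          exact ⟨this.1, this.2.1⟩
        · rintro ⟨s, s'⟩ _ ⟨t, t'⟩ _ hh
          simp only [Prod.mk.injEq] at hh
          obtain ⟨rfl, rfl⟩ := hh
          rfl
    _ ≤ 4 := by rw [Finset.card_product]; nlinarith

/-- The lines in a direction in `K` that agree with `c` off `K`. -/
def sliceLines (K : Finset (Fin n)) (c : Fin n → Fin k) : Set (Line n k) :=
  {l | ∃ i ∈ K, ∃ v, (∀ j, j ∉ K → v j = c j) ∧ l = lineOf i v}

theorem missDirs_congr {B : Fin k → Finset (Fin k)} {K : Finset (Fin n)} {ω ω' : Line n k → Fin k}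
    {c v : Fin n → Fin k} (h : ∀ l ∈ sliceLines K c, ω l = ω' l) (hv : ∀ j, j ∉ K → v j = c j) :
    missDirs B K ω v = missDirs B K ω' v :=
  Finset.filter_congr fun i hi => by rw [h _ ⟨i, hi, v, hv, rfl⟩]

/-- The vertices reached from `c` by two moves in directions in `K`. -/
def outNbrs (K : Finset (Fin n)) (ω : Line n k → Fin k) (c : Fin n → Fin k) :
    Finset (Fin n → Fin k) :=
  secondNbrs (missDirs (fun x => {x}) K ω) (fun s v => Function.update v s (ω (lineOf s v))) c

theorem outNbrs_congr {K : Finset (Fin n)} {ω ω' : Line n k → Fin k}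
    {c : Fin n → Fin k} (h : ∀ l ∈ sliceLines K c, ω l = ω' l) :
    outNbrs K ω c = outNbrs K ω' c :=
  secondNbrs_congr (fun _ hv => missDirs_congr h hv)
    (fun s hs v hv => by rw [h _ ⟨s, hs, v, hv, rfl⟩]) (fun _ => Finset.filter_subset _ _)
    (fun s v j hj => by simp [hj])

theorem secondNbrs_eq_off {D : (Fin n → Fin k) → Finset (Fin n)}
    {F : Fin n → (Fin n → Fin k) → (Fin n → Fin k)} {c x : Fin n → Fin k} {K : Finset (Fin n)}
    (hK : ∀ v, D v ⊆ K) (hFK : ∀ s v j, j ≠ s → F s v j = v j) (hx : x ∈ secondNbrs D F c)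
    {j : Fin n} (hj : j ∉ K) : x j = c j := by
  obtain ⟨s, hs, s', hs', rfl⟩ := mem_secondNbrs.1 hx
  rw [hFK s' _ j (by rintro rfl; exact hj (hK _ hs')),
    hFK s _ j (by rintro rfl; exact hj (hK _ hs))]

theorem outNbrs_eq_off {K : Finset (Fin n)} {ω : Line n k → Fin k} {c x : Fin n → Fin k}
    (hx : x ∈ outNbrs K ω c) {j : Fin n} (hj : j ∉ K) : x j = c j :=
  secondNbrs_eq_off (fun _ => Finset.filter_subset _ _) (fun s v j hj => by simp [hj]) hx hj

theorem reach_of_mem_outNbrs {K : Finset (Fin n)} {ω : Line n k → Fin k} {c x : Fin n → Fin k}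
    (hx : x ∈ outNbrs K ω c) : Reach ω c x := by
  obtain ⟨s, hs, s', hs', rfl⟩ := mem_secondNbrs.1 hx
  have h1 := (mem_missDirs.1 hs).2
  have h2 := (mem_missDirs.1 hs').2
  simp only [Finset.mem_singleton] at h1 h2
  exact (Relation.ReflTransGen.single ⟨s, rfl, fun h => h1 h.symm⟩).tail
    ⟨s', rfl, fun h => h2 h.symm⟩

theorem card_outNbrs {K : Finset (Fin n)} {ω : Line n k → Fin k} {c : Fin n → Fin k} {h : ℕ}
    (hs : Spread 2 (fun x => {x}) K h ω) (hc : h < (missDirs (fun x => {x}) K ω c).card) :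
    h * h ≤ 4 * (outNbrs K ω c).card := by
  have := card_secondNbrs (D := missDirs (fun x => {x}) K ω)
    (F := fun s v => Function.update v s (ω (lineOf s v))) (c := c) (h := h) (R := 2)
    (fun s v hsv => by simpa using (mem_missDirs.1 hsv).2) (fun s v j hj => by simp [hj])
    (fun s v _ => by simp [mem_missDirs]) hc
    (hs.card_filter_lt c (fun s => ω (lineOf s c)) _
      fun s hsv => by simpa using (mem_missDirs.1 hsv).2)
  simpa [outNbrs] using this

/-- Vertices that reach `c` by two moves in directions in `K`. -/
def inNbrs [NeZero k] (K : Finset (Fin n)) (ω : Line n k → Fin k) (c : Fin n → Fin k) :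
    Finset (Fin n → Fin k) :=
  secondNbrs (missDirs (fun x => {x}ᶜ) K ω) (fun s v => Function.update v s (v s + 1)) c

theorem inNbrs_congr [NeZero k] {K : Finset (Fin n)} {ω ω' : Line n k → Fin k}
    {c : Fin n → Fin k} (h : ∀ l ∈ sliceLines K c, ω l = ω' l) :
    inNbrs K ω c = inNbrs K ω' c :=
  secondNbrs_congr (fun _ hv => missDirs_congr h hv)
    (fun _ _ _ _ => rfl) (fun _ => Finset.filter_subset _ _) (fun s v j hj => by simp [hj])

theorem inNbrs_eq_off [NeZero k] {K : Finset (Fin n)} {ω : Line n k → Fin k} {c x : Fin n → Fin k}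
    (hx : x ∈ inNbrs K ω c) {j : Fin n} (hj : j ∉ K) : x j = c j :=
  secondNbrs_eq_off (fun _ => Finset.filter_subset _ _) (fun s v j hj => by simp [hj]) hx hj

theorem add_one_ne_self [NeZero k] (hk : 2 ≤ k) (x : Fin k) : x + 1 ≠ x := by
  intro h
  have h1 : (1 : Fin k) = 0 := by simpa using h
  have h2 := congrArg Fin.val h1
  rw [Fin.val_one', Nat.mod_eq_of_lt (by omega)] at h2
  simp at h2

/-- In such a direction `v` is the best response, so all other vertices of the line move to `v`;
adding 1 merely selects one of them. -/
theorem move_of_mem_missDirs [NeZero k] (hk : 2 ≤ k) {K : Finset (Fin n)} {ω : Line n k → Fin k}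
    {v : Fin n → Fin k} {s : Fin n} (hs : s ∈ missDirs (fun x => {x}ᶜ) K ω v) :
    Move ω (Function.update v s (v s + 1)) v := by
  have h1 : ω (lineOf s v) = v s := by simpa using (mem_missDirs.1 hs).2
  exact ⟨s, by simp [h1], by simpa [h1] using add_one_ne_self hk (v s)⟩

theorem reach_of_mem_inNbrs [NeZero k] (hk : 2 ≤ k) {K : Finset (Fin n)} {ω : Line n k → Fin k}
    {c x : Fin n → Fin k} (hx : x ∈ inNbrs K ω c) : Reach ω x c := by
  obtain ⟨s, hs, s', hs', rfl⟩ := mem_secondNbrs.1 hx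
  exact (Relation.ReflTransGen.single (move_of_mem_missDirs hk hs')).tail
    (move_of_mem_missDirs hk hs)

theorem card_inNbrs [NeZero k] (hk : 2 ≤ k) {K : Finset (Fin n)} {ω : Line n k → Fin k}
    {c : Fin n → Fin k} {h : ℕ} (hs : Spread k (fun x => {x}ᶜ) K h ω)
    (hc : h < (missDirs (fun x => {x}ᶜ) K ω c).card) :
    (h + 2 - k) * h ≤ 4 * (inNbrs K ω c).card :=
  card_secondNbrs (D := missDirs (fun x => {x}ᶜ) K ω)
    (F := fun s v => Function.update v s (v s + 1)) (c := c) (h := h) (R := k)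
    (fun s v _ => by simpa using add_one_ne_self hk (v s)) (fun s v j hj => by simp [hj])
    (fun s v hsv => by
      have h1 : ω (lineOf s v) = v s := by simpa using (mem_missDirs.1 hsv).2
      rw [mem_missDirs]
      rintro ⟨-, h2⟩
      apply h2
      rw [lineOf_update, Function.update_self, h1, Finset.mem_compl, Finset.mem_singleton]
      exact (add_one_ne_self hk (v s)).symm) hc
    (hs.card_filter_lt c (fun s => c s + 1) _ fun s _ => add_one_ne_self hk (c s))

/-- A non-sink and one of its successors are two distinct vertices of a ball of radius one, so one
of them is rich. -/
theorem exists_reach_of_spread {K : Finset (Fin n)} {ω : Line n k → Fin k} {h : ℕ}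
    (hs : Spread 2 (fun x => {x}) K h ω) {a : Fin n → Fin k} (ha : ∃ a', Move ω a a') :
    ∃ a', Reach ω a a' ∧ h < (missDirs (fun x => {x}) K ω a').card := by
  obtain ⟨_, i, rfl, hne⟩ := ha
  obtain ⟨r, hr⟩ := hs a ![(i, a i), (i, ω (lineOf i a))] (by
    intro r r' hrr
    have := congrFun hrr i
    fin_cases r <;> fin_cases r' <;> simp_all)
  fin_cases r
  · exact ⟨a, Relation.ReflTransGen.refl, by simpa using hr⟩
  · exact ⟨_, Relation.ReflTransGen.single ⟨i, rfl, hne⟩, by simpa using hr⟩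

/-- A non-source is the best response on some line, and all `k` vertices of that line reach it; one
of them is rich. -/
theorem exists_reach_to_of_spread {K : Finset (Fin n)} {ω : Line n k → Fin k} {h : ℕ}
    (hs : Spread k (fun x => {x}ᶜ) K h ω) {b : Fin n → Fin k} (hb : ∃ b', Move ω b' b) :
    ∃ b', Reach ω b' b ∧ h < (missDirs (fun x => {x}ᶜ) K ω b').card := by
  obtain ⟨b₀, i, rfl, -⟩ := hb
  obtain ⟨r, hr⟩ := hs b₀ (fun r => (i, r)) (by
    intro r r' hrr
    simpa using congrFun hrr i)
  refine ⟨_, ?_, hr⟩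
  by_cases hr' : r = ω (lineOf i b₀)
  · rw [← hr']; exact Relation.ReflTransGen.refl
  · exact Relation.ReflTransGen.single ⟨i, by simp, by simpa using hr'⟩

end Degrees

/-! ### Many independent attempts at joining two vertices -/

section Link

variable {n k : ℕ}

/-- The profile that agrees with `x` on `K` and with `τ` off `K`. -/
def mix (K : Finset (Fin n)) (τ x : Fin n → Fin k) : Fin n → Fin k :=
  fun i => if i ∈ K then x i else τ i

theorem mix_of_mem {K : Finset (Fin n)} (τ x : Fin n → Fin k) {i : Fin n} (hi : i ∈ K) :
    mix K τ x i = x i := if_pos hi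

theorem mix_of_notMem {K : Finset (Fin n)} (τ x : Fin n → Fin k) {i : Fin n} (hi : i ∉ K) :
    mix K τ x i = τ i := if_neg hi

/-- The lines in a direction off `K` that agree with `c` on `K`. -/
def fiberLines (K : Finset (Fin n)) (c : Fin n → Fin k) : Set (Line n k) :=
  {l | ∃ i ∉ K, ∃ v, (∀ j ∈ K, v j = c j) ∧ l = lineOf i v}

theorem disjoint_fiberLines_sliceLines {K : Finset (Fin n)} {c c' : Fin n → Fin k} :
    Disjoint (fiberLines K c) (sliceLines K c') := by
  rw [Set.disjoint_left]
  rintro _ ⟨i, hi, v, -, rfl⟩ ⟨i', hi', v', -, h⟩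
  exact hi ((lineOf_eq_iff.1 h).1 ▸ hi')

theorem disjoint_fiberLines {K : Finset (Fin n)} {c c' : Fin n → Fin k}
    (h : ¬ ∀ j ∈ K, c j = c' j) : Disjoint (fiberLines K c) (fiberLines K c') := by
  rw [Set.disjoint_left]
  rintro _ ⟨i, hi, v, hv, rfl⟩ ⟨i', hi', v', hv', hl⟩
  refine h fun j hj => ?_
  rw [← hv j hj, ← hv' j hj]
  exact (lineOf_eq_iff.1 hl).2 j (by rintro rfl; exact hi hj)

theorem disjoint_sliceLines {K : Finset (Fin n)} {c c' : Fin n → Fin k}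
    (h : ¬ ∀ j, j ∉ K → c j = c' j) : Disjoint (sliceLines K c) (sliceLines K c') := by
  rw [Set.disjoint_left]
  rintro _ ⟨i, hi, v, hv, rfl⟩ ⟨i', hi', v', hv', hl⟩
  refine h fun j hj => ?_
  rw [← hv j hj, ← hv' j hj]
  exact (lineOf_eq_iff.1 hl).2 j (by rintro rfl; exact hj hi)

theorem boxLines_subset_fiberLines {K : Finset (Fin n)} {x y : Fin n → Fin k}
    (h : ∀ j ∈ K, x j = y j) : boxLines x y ⊆ fiberLines K x := by
  rintro _ ⟨v, i, rfl, hi, hv⟩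
  exact ⟨i, fun hK => hi (h i hK), v, fun j hj => (hv j).elim id fun h' => h'.trans (h j hj).symm,
    rfl⟩

theorem boxLines_subset_sliceLines {K : Finset (Fin n)} {x y : Fin n → Fin k}
    (h : ∀ j, j ∉ K → x j = y j) : boxLines x y ⊆ sliceLines K x := by
  rintro _ ⟨v, i, rfl, hi, hv⟩
  exact ⟨i, by_contra fun hK => hi (h i hK), v,
    fun j hj => (hv j).elim id fun h' => h'.trans (h j hj).symm, rfl⟩

theorem fiberLines_congr {K : Finset (Fin n)} {x y : Fin n → Fin k}
    (h : ∀ j ∈ K, x j = y j) : fiberLines K x = fiberLines K y := by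
  ext l
  refine exists_congr fun i => and_congr_right fun _ => exists_congr fun v =>
    and_congr_left fun _ => forall₂_congr fun j hj => by rw [h j hj]

theorem sliceLines_congr {K : Finset (Fin n)} {x y : Fin n → Fin k}
    (h : ∀ j, j ∉ K → x j = y j) : sliceLines K x = sliceLines K y := by
  ext l
  refine exists_congr fun i => and_congr_right fun _ => exists_congr fun v =>
    and_congr_left fun _ => forall₂_congr fun j hj => by rw [h j hj]

theorem exists_injective_mem {α : Type*} {s : Finset α} {M : ℕ} (h : M ≤ s.card) :
    ∃ f : Fin M → α, Function.Injective f ∧ ∀ t, f t ∈ s := by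
  obtain ⟨f⟩ : Nonempty (Fin M ↪ s) := Function.Embedding.nonempty_of_card_le (by simpa)
  exact ⟨fun t => f t, fun t t' h => f.injective (Subtype.ext h), fun t => (f t).2⟩

/-- Pairwise distinct actions of the players off `K`, all different from those in `a` and `b`. -/
theorem exists_tags [NeZero k] (K : Finset (Fin n)) (a b : Fin n → Fin k) {M : ℕ}
    (hM : M + 2 ≤ k ^ Kᶜ.card) :
    ∃ τ : Fin M → Fin n → Fin k, (∀ t t', (∀ j, j ∉ K → τ t j = τ t' j) → t = t') ∧
      (∀ t, ¬ ∀ j, j ∉ K → a j = τ t j) ∧ ∀ t, ¬ ∀ j, j ∉ K → b j = τ t j := by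
  classical
  let a' : {i // i ∉ K} → Fin k := fun i => a i
  let b' : {i // i ∉ K} → Fin k := fun i => b i
  have hcard : M ≤ (Finset.univ \ {a', b'} : Finset ({i // i ∉ K} → Fin k)).card := by
    have h1 := Finset.le_card_sdiff {a', b'} (Finset.univ : Finset ({i // i ∉ K} → Fin k))
    have h2 : ({a', b'} : Finset ({i // i ∉ K} → Fin k)).card ≤ 2 := Finset.card_le_two
    have h3 : Fintype.card {i // i ∉ K} = Kᶜ.card := by
      rw [Fintype.card_subtype]; congr 1; ext; simp
    rw [Finset.card_univ, Fintype.card_fun, Fintype.card_fin, h3] at h1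
    omega
  obtain ⟨f, hf, hfs⟩ := exists_injective_mem hcard
  have hfs' : ∀ t, f t ≠ a' ∧ f t ≠ b' := fun t => by simpa using hfs t
  let τ : Fin M → Fin n → Fin k := fun t i => if h : i ∉ K then f t ⟨i, h⟩ else 0
  have hτ : ∀ t i (h : i ∉ K), τ t i = f t ⟨i, h⟩ := fun t i h => by simp [τ, h]
  refine ⟨τ, fun t t' h => hf ?_, fun t h => (hfs' t).1 ?_, fun t h => (hfs' t).2 ?_⟩
  · funext i
    rw [← hτ t i i.2, ← hτ t' i i.2, h i i.2]
  · funext i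
    rw [← hτ t i i.2, ← h i i.2]
  · funext i
    rw [← hτ t i i.2, ← h i i.2]

/-- Three greedy legs: the coordinates off `K` change to the tag `τ`, then those in `K` change from
`x` to `y`, then those off `K` change to `y`. The first and third legs carry the `K`-parts of `x`
and `y`, the second carries `τ`; this keeps the legs, and later the attempts, on disjoint lines. -/
theorem exists_attempt_event [NeZero k] (K : Finset (Fin n)) (x y τ : Fin n → Fin k)
    (hxy : ¬ ∀ j ∈ K, x j = y j) :
    ∃ E : Set (Line n k → Fin k),
      DepOn E (fiberLines K x ∪ (sliceLines K τ ∪ fiberLines K y)) ∧ (∀ ω ∈ E, Reach ω x y) ∧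
      Real.exp (-(k ^ 2 : ℝ)) ^ 3 ≤ pr E := by
  obtain ⟨E₁, h11, h12, h13⟩ := exists_path_event x (mix K τ x)
  obtain ⟨E₂, h21, h22, h23⟩ := exists_path_event (mix K τ x) (mix K τ y)
  obtain ⟨E₃, h31, h32, h33⟩ := exists_path_event (mix K τ y) y
  replace h11 := h11.mono (boxLines_subset_fiberLines fun j hj => (mix_of_mem τ x hj).symm)
  replace h21 := h21.mono (boxLines_subset_sliceLines (K := K) fun j hj => by
    rw [mix_of_notMem τ x hj, mix_of_notMem τ y hj])
  rw [sliceLines_congr fun j hj => mix_of_notMem τ x hj] at h21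
  replace h31 := h31.mono (boxLines_subset_fiberLines fun j hj => mix_of_mem τ y hj)
  rw [fiberLines_congr fun j hj => mix_of_mem τ y hj] at h31
  refine ⟨E₁ ∩ (E₂ ∩ E₃), h11.inter (h21.inter h31),
    fun ω hω => (h12 ω hω.1).trans ((h22 ω hω.2.1).trans (h32 ω hω.2.2)), ?_⟩
  rw [pr_inter h11 (h21.inter h31) (Set.disjoint_union_right.2
      ⟨disjoint_fiberLines_sliceLines, disjoint_fiberLines hxy⟩),
    pr_inter h21 h31 disjoint_fiberLines_sliceLines.symm]
  have hp := Real.exp_pos (-(k ^ 2 : ℝ))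
  have hp1 := pr_nonneg E₁
  have hp2 := pr_nonneg E₂
  calc Real.exp (-(k ^ 2 : ℝ)) ^ 3 = Real.exp (-(k ^ 2 : ℝ)) *
        (Real.exp (-(k ^ 2 : ℝ)) * Real.exp (-(k ^ 2 : ℝ))) := by ring
    _ ≤ _ := by gcongr

/-- Large sets `X` and `Y` of vertices are joined by a path with high probability, and for this it
is enough to look at lines that do not lie in the slices of `a` and `b`. -/
theorem exists_link_event [NeZero k] (K : Finset (Fin n)) (a b : Fin n → Fin k) {M : ℕ}
    (hM : M + 2 ≤ k ^ Kᶜ.card) {X Y : Finset (Fin n → Fin k)}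
    (hX : ∀ x ∈ X, ∀ j, j ∉ K → x j = a j) (hY : ∀ y ∈ Y, ∀ j, j ∉ K → y j = b j)
    (hXM : 2 * M ≤ X.card) (hYM : 2 * M ≤ Y.card) :
    ∃ (F : Set (Line n k → Fin k)) (S : Set (Line n k)), DepOn F S ∧
      Disjoint (sliceLines K a ∪ sliceLines K b) S ∧
      (∀ ω, ω ∉ F → ∃ x ∈ X, ∃ y ∈ Y, Reach ω x y) ∧
      pr F ≤ (1 - Real.exp (-(k ^ 2 : ℝ)) ^ 3) ^ M := by
  classical
  obtain ⟨τ, hτ, hτa, hτb⟩ := exists_tags K a b hM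
  obtain ⟨x, hx, hxX⟩ := exists_injective_mem (M := M) (s := X) (by omega)
  -- No `y t` may share its `K`-part with any `x s`, lest their fibers coincide. This discards at
  -- most `M` elements of `Y`, whence the factor 2 in `hYM`.
  obtain ⟨y, hy, hyY⟩ := exists_injective_mem (M := M)
    (s := Y \ (Finset.univ.image fun t => mix K b (x t))) (by
      have h1 := Finset.le_card_sdiff (Finset.univ.image fun t => mix K b (x t)) Y
      have h2 : (Finset.univ.image fun t => mix K b (x t)).card ≤ M :=
        Finset.card_image_le.trans (by simp)
      omega)
  have hyY' : ∀ t, y t ∈ Y := fun t => (Finset.mem_sdiff.1 (hyY t)).1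
  have hxy : ∀ s t, ¬ ∀ j ∈ K, x s j = y t j := by
    intro s t h
    refine (Finset.mem_sdiff.1 (hyY t)).2 (Finset.mem_image.2 ⟨s, by simp, ?_⟩)
    funext j
    by_cases hj : j ∈ K
    · rw [mix_of_mem _ _ hj, h j hj]
    · rw [mix_of_notMem _ _ hj, hY _ (hyY' t) j hj]
  have hxx : ∀ s t, s ≠ t → ¬ ∀ j ∈ K, x s j = x t j := by
    intro s t hst h
    refine hst (hx (funext fun j => ?_))
    by_cases hj : j ∈ K
    · exact h j hj
    · rw [hX _ (hxX s) j hj, hX _ (hxX t) j hj]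
  have hyy : ∀ s t, s ≠ t → ¬ ∀ j ∈ K, y s j = y t j := by
    intro s t hst h
    refine hst (hy (funext fun j => ?_))
    by_cases hj : j ∈ K
    · exact h j hj
    · rw [hY _ (hyY' s) j hj, hY _ (hyY' t) j hj]
  choose E hE1 hE2 hE3 using fun t => exists_attempt_event K (x t) (y t) (τ t) (hxy t t)
  refine ⟨⋂ t, (E t)ᶜ, ⋃ t, (fiberLines K (x t) ∪ (sliceLines K (τ t) ∪ fiberLines K (y t))),
    ?_, ?_, ?_, ?_⟩
  · intro ω ω' hω h
    simp only [Set.mem_iInter] at h ⊢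
    exact fun t => (hE1 t).compl ω ω' (fun l hl => hω l (Set.mem_iUnion.2 ⟨t, hl⟩)) (h t)
  · rw [Set.disjoint_iUnion_right]
    intro t
    rw [Set.disjoint_union_left]
    refine ⟨Set.disjoint_union_right.2 ⟨disjoint_fiberLines_sliceLines.symm,
      Set.disjoint_union_right.2 ⟨disjoint_sliceLines (hτa t),
        disjoint_fiberLines_sliceLines.symm⟩⟩,
      Set.disjoint_union_right.2 ⟨disjoint_fiberLines_sliceLines.symm,
      Set.disjoint_union_right.2 ⟨disjoint_sliceLines (hτb t),
        disjoint_fiberLines_sliceLines.symm⟩⟩⟩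
  · intro ω hω
    simp only [Set.mem_iInter, Set.mem_compl_iff, not_forall, not_not] at hω
    obtain ⟨t, ht⟩ := hω
    exact ⟨x t, hxX t, y t, hyY' t, hE2 t ω ht⟩
  · rw [pr_iInter (fun t => (hE1 t).compl)]
    · calc ∏ t, pr (E t)ᶜ ≤ ∏ _t : Fin M, (1 - Real.exp (-(k ^ 2 : ℝ)) ^ 3) :=
            Finset.prod_le_prod (fun _ _ => pr_nonneg _) fun t _ => by
              rw [pr_compl]; linarith [hE3 t]
        _ = _ := by simp
    · intro s t hst
      have hfs : ∀ u v : Fin n → Fin k, Disjoint (fiberLines K u) (sliceLines K v) :=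
        fun _ _ => disjoint_fiberLines_sliceLines
      simp only [Function.onFun, Set.disjoint_union_left, Set.disjoint_union_right]
      exact ⟨⟨disjoint_fiberLines (hxx s t hst), (hfs _ _).symm,
          disjoint_fiberLines fun h => hxy t s fun j hj => (h j hj).symm⟩,
        ⟨hfs _ _, disjoint_sliceLines fun h => hst (hτ s t h), hfs _ _⟩,
        disjoint_fiberLines (hxy s t), (hfs _ _).symm, disjoint_fiberLines (hyy s t hst)⟩

/-- The second neighbourhoods are determined by the slices of `a` and `b`. Conditionally on them,
the attempts of `exists_link_event` use fresh lines. -/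
theorem pr_not_reach_le [NeZero k] (hk : 2 ≤ k) (K : Finset (Fin n)) (a b : Fin n → Fin k) {M : ℕ}
    (hM : M + 2 ≤ k ^ Kᶜ.card) :
    pr {ω : Line n k → Fin k | 2 * M ≤ (outNbrs K ω a).card ∧ 2 * M ≤ (inNbrs K ω b).card ∧
      ¬ Reach ω a b} ≤ (1 - Real.exp (-(k ^ 2 : ℝ)) ^ 3) ^ M := by
  classical
  let Z : (Line n k → Fin k) → Finset (Fin n → Fin k) × Finset (Fin n → Fin k) :=
    fun ω => (outNbrs K ω a, inNbrs K ω b)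
  let B : Set (Finset (Fin n → Fin k) × Finset (Fin n → Fin k)) :=
    {z | (∀ x ∈ z.1, ∀ j, j ∉ K → x j = a j) ∧ (∀ y ∈ z.2, ∀ j, j ∉ K → y j = b j) ∧
      2 * M ≤ z.1.card ∧ 2 * M ≤ z.2.card}
  have hZ : ∀ ω ω' : Line n k → Fin k, (∀ l ∈ sliceLines K a ∪ sliceLines K b, ω l = ω' l) →
      Z ω = Z ω' := fun ω ω' h => Prod.ext
    (outNbrs_congr fun l hl => h l (Or.inl hl)) (inNbrs_congr fun l hl => h l (Or.inr hl))
  have hex : ∀ z ∈ B, ∃ (F : Set (Line n k → Fin k)) (S : Set (Line n k)), DepOn F S ∧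
      Disjoint (sliceLines K a ∪ sliceLines K b) S ∧
      (∀ ω, ω ∉ F → ∃ x ∈ z.1, ∃ y ∈ z.2, Reach ω x y) ∧
      pr F ≤ (1 - Real.exp (-(k ^ 2 : ℝ)) ^ 3) ^ M :=
    fun z hz => exists_link_event K a b hM hz.1 hz.2.1 hz.2.2.1 hz.2.2.2
  choose! F S h1 h2 h3 h4 using hex
  have hexp : Real.exp (-(k ^ 2 : ℝ)) ^ 3 ≤ 1 :=
    pow_le_one₀ (Real.exp_pos _).le (Real.exp_le_one_iff.2 (by simp))
  refine (pr_mono ?_).trans (pr_le_of_cond hZ h1 h2 h4 (pow_nonneg (by linarith) M))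
  rintro ω ⟨hX, hY, hr⟩
  have hB : Z ω ∈ B := ⟨fun x hx j hj => outNbrs_eq_off hx hj,
    fun y hy j hj => inNbrs_eq_off hy hj, hX, hY⟩
  refine ⟨hB, ?_⟩
  by_contra hF
  obtain ⟨x, hx, y, hy, hxy⟩ := h3 _ hB ω hF
  exact hr ((reach_of_mem_outNbrs hx).trans (hxy.trans (reach_of_mem_inNbrs hk hy)))

/-- When both `Spread` conditions hold, it suffices to join rich vertices, whose second
neighbourhoods have at least `2 * M` elements by `hh`; the last summand is the union bound over all
pairs. -/
theorem pr_compl_linkedTables_le [NeZero k] (hk : 2 ≤ k) (K : Finset (Fin n)) {h M : ℕ}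
    (hM : M + 2 ≤ k ^ Kᶜ.card) (hh : 8 * M ≤ (h + 2 - k) * h) :
    pr (linkedTables n k)ᶜ ≤ pr {ω : Line n k → Fin k | ¬ Spread 2 (fun x => {x}) K h ω} +
      pr {ω : Line n k → Fin k | ¬ Spread k (fun x => {x}ᶜ) K h ω} +
      (k ^ n * k ^ n : ℝ) * (1 - Real.exp (-(k ^ 2 : ℝ)) ^ 3) ^ M := by
  classical
  have hsub : (linkedTables n k)ᶜ ⊆ ({ω | ¬ Spread 2 (fun x => {x}) K h ω} ∪
      {ω | ¬ Spread k (fun x => {x}ᶜ) K h ω}) ∪ ⋃ p : (Fin n → Fin k) × (Fin n → Fin k),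
        {ω | 2 * M ≤ (outNbrs K ω p.1).card ∧ 2 * M ≤ (inNbrs K ω p.2).card ∧
          ¬ Reach ω p.1 p.2} := by
    intro ω hω
    by_cases hs1 : Spread 2 (fun x => {x}) K h ω
    swap
    · exact Or.inl (Or.inl hs1)
    by_cases hs2 : Spread k (fun x => {x}ᶜ) K h ω
    swap
    · exact Or.inl (Or.inr hs2)
    right
    simp only [linkedTables, Set.mem_compl_iff, Set.mem_ofPred_eq, not_forall] at hω
    obtain ⟨a, b, ha, hb, hab⟩ := hω
    obtain ⟨a', haa, ha'⟩ := exists_reach_of_spread hs1 ha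
    obtain ⟨b', hbb, hb'⟩ := exists_reach_to_of_spread hs2 hb
    have h1 := card_outNbrs hs1 ha'
    have h2 := card_inNbrs hk hs2 hb'
    have h3 : (h + 2 - k) * h ≤ h * h := Nat.mul_le_mul_right _ (by omega)
    exact Set.mem_iUnion.2 ⟨(a', b'), by dsimp only; omega, by dsimp only; omega,
      fun hr => hab (haa.trans (hr.trans hbb))⟩
  refine (pr_mono hsub).trans ((pr_union_le _ _).trans (add_le_add (pr_union_le _ _)
    ((pr_iUnion_le _).trans ((Finset.sum_le_card_nsmul _ _ _
      fun p _ => pr_not_reach_le hk K p.1 p.2 hM).trans (le_of_eq ?_)))))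
  simp [Fintype.card_prod, nsmul_eq_mul]

end Link

/-! ### Super-connected tables exist -/

section Existence

variable {n k : ℕ}

theorem reach_update (ω : Line n k → Fin k) (a : Fin n → Fin k) (i : Fin n) :
    Reach ω a (Function.update a i (ω (lineOf i a))) := by
  by_cases h : a i = ω (lineOf i a)
  · rw [← h, Function.update_eq_self]; exact Relation.ReflTransGen.refl
  · exact Relation.ReflTransGen.single ⟨i, rfl, h⟩

/-- `s` is a sink of the best-response graph, and every other vertex reaches every vertex. -/
def IsHub (ω : Line n k → Fin k) (s : Fin n → Fin k) : Prop :=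
  (∀ i, ω (lineOf i s) = s i) ∧ ∀ a, a ≠ s → ∀ b, Reach ω a b

theorem IsHub.mem {ω : Line n k → Fin k} {s : Fin n → Fin k} (h : IsHub ω s) :
    ω ∈ nashTables n k ∩ linkedTables n k := by
  refine ⟨⟨s, h.1⟩, fun a b ha _ => h.2 a ?_ b⟩
  rintro rfl
  obtain ⟨_, i, -, hne⟩ := ha
  exact hne (h.1 i).symm

/-- The translate of a table. -/
def translateTable [NeZero k] (ω : Line n k → Fin k) (t : Fin n → Fin k) : Line n k → Fin k :=
  fun l => ω ⟨l.1, fun j => l.2 j - t j⟩ + t l.1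

theorem translateTable_lineOf [NeZero k] (ω : Line n k → Fin k) (t a : Fin n → Fin k) (i : Fin n) :
    translateTable ω t (lineOf i (a + t)) = ω (lineOf i a) + t i := by
  simp [translateTable, lineOf]

theorem Reach.translate [NeZero k] {ω : Line n k → Fin k} (t : Fin n → Fin k)
    {a b : Fin n → Fin k} (h : Reach ω a b) : Reach (translateTable ω t) (a + t) (b + t) := by
  refine Relation.ReflTransGen.lift (fun v => v + t) ?_ _ _ h
  rintro a _ ⟨i, rfl, hne⟩
  refine ⟨i, ?_, ?_⟩
  · rw [translateTable_lineOf]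
    funext j
    by_cases hj : j = i
    · subst hj; simp
    · simp [hj]
  · rw [translateTable_lineOf]
    simpa using hne

theorem IsHub.translate [NeZero k] {ω : Line n k → Fin k} {s : Fin n → Fin k} (h : IsHub ω s)
    (t : Fin n → Fin k) : IsHub (translateTable ω t) (s + t) := by
  refine ⟨fun i => by rw [translateTable_lineOf, h.1]; rfl, fun a ha b => ?_⟩
  have := (h.2 (a - t) (fun he => ha (by rw [← he, sub_add_cancel])) (b - t)).translate t
  simpa using this

/-- The table with an additional player `0`, whose best responses are given by `w`; the tables of
the other players depend on the action of player `0`. -/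
def extendTable (w : (Fin n → Fin k) → Fin k) (ω : Fin k → Line n k → Fin k) :
    Line (n + 1) k → Fin k := fun l =>
  Fin.cases (motive := fun i => ({j : Fin (n + 1) // j ≠ i} → Fin k) → Fin k)
    (fun r => w fun j => r ⟨j.succ, Fin.succ_ne_zero j⟩)
    (fun i r => ω (r ⟨0, (Fin.succ_ne_zero i).symm⟩)
      ⟨i, fun j => r ⟨(j : Fin n).succ, fun h => j.2 (Fin.succ_injective _ h)⟩⟩) l.1 l.2

theorem extendTable_zero (w : (Fin n → Fin k) → Fin k) (ω : Fin k → Line n k → Fin k) (c : Fin k)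
    (v : Fin n → Fin k) : extendTable w ω (lineOf 0 (Fin.cons c v)) = w v := by
  simp [extendTable, lineOf]

theorem extendTable_succ (w : (Fin n → Fin k) → Fin k) (ω : Fin k → Line n k → Fin k) (c : Fin k)
    (v : Fin n → Fin k) (i : Fin n) :
    extendTable w ω (lineOf i.succ (Fin.cons c v)) = ω c (lineOf i v) := by
  simp [extendTable, lineOf]

theorem reach_extendTable (w : (Fin n → Fin k) → Fin k) (ω : Fin k → Line n k → Fin k)
    (c : Fin k) {v v' : Fin n → Fin k} (h : Reach (ω c) v v') :
    Reach (extendTable w ω) (Fin.cons c v) (Fin.cons c v') := by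
  refine Relation.ReflTransGen.lift (fun v => (Fin.cons c v : Fin (n + 1) → Fin k)) ?_ _ _ h
  rintro a _ ⟨i, rfl, hne⟩
  refine ⟨i.succ, ?_, ?_⟩
  · rw [extendTable_succ]; exact Fin.cons_update _ _ _ _
  · rw [extendTable_succ]; simpa using hne

theorem reach_extendTable_zero (w : (Fin n → Fin k) → Fin k) (ω : Fin k → Line n k → Fin k)
    (c : Fin k) (v : Fin n → Fin k) :
    Reach (extendTable w ω) (Fin.cons c v) (Fin.cons (w v) v) := by
  have := reach_update (extendTable w ω) (Fin.cons c v) 0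
  rwa [extendTable_zero, Fin.update_cons_zero] at this

/-- Layer `c₀` of the new player gets a table with hub `s`, all other layers one with hub `u ≠ s`.
The new player leads from `(c, u)` to `(c₀, u)`, and from `(c₀, e c)` to `(c, e c)`. So all vertices
but the sink flow to `(c₀, u)`, and from there every layer is entered at a vertex that reaches all
of it. The hypothesis `hcard` makes room for `s`, `u` and the `k` vertices `e c`. -/
theorem exists_isHub_succ [NeZero k] (hcard : k + 2 ≤ k ^ n)
    (h : ∀ s : Fin n → Fin k, ∃ ω, IsHub ω s) (s : Fin (n + 1) → Fin k) :
    ∃ ω, IsHub ω s := by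
  classical
  obtain ⟨c₀, s, rfl⟩ : ∃ c₀ s', s = Fin.cons c₀ s' := ⟨s 0, Fin.tail s, (Fin.cons_self_tail s).symm⟩
  have hN : Fintype.card (Fin n → Fin k) = k ^ n := by simp
  have hk1 : 1 ≤ k := NeZero.one_le
  obtain ⟨u, hu⟩ : ∃ u, u ≠ s := Fintype.exists_ne_of_one_lt_card (by omega) s
  obtain ⟨ωs, hs1, hs2⟩ := h s
  obtain ⟨ωu, hu1, hu2⟩ := h u
  obtain ⟨e, he, hes⟩ := exists_injective_mem (M := k)
    (s := (Finset.univ \ {s, u} : Finset (Fin n → Fin k))) (by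
      have h1 := Finset.le_card_sdiff {s, u} (Finset.univ : Finset (Fin n → Fin k))
      have h2 : ({s, u} : Finset (Fin n → Fin k)).card ≤ 2 := Finset.card_le_two
      rw [Finset.card_univ, hN] at h1
      omega)
  have hes' : ∀ c, e c ≠ s ∧ e c ≠ u := fun c => by simpa using hes c
  let w : (Fin n → Fin k) → Fin k := Function.extend e id fun _ => c₀
  have hwe : ∀ c, w (e c) = c := fun c => he.extend_apply _ _ c
  have hws : w s = c₀ := Function.extend_apply' _ _ _ fun ⟨c, hc⟩ => (hes' c).1 hc
  have hwu : w u = c₀ := Function.extend_apply' _ _ _ fun ⟨c, hc⟩ => (hes' c).2 hc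
  let ω : Fin k → Line n k → Fin k := fun c => if c = c₀ then ωs else ωu
  have hω0 : ω c₀ = ωs := if_pos rfl
  have hω1 : ∀ c, c ≠ c₀ → ω c = ωu := fun c hc => if_neg hc
  have hto : ∀ c v, Fin.cons c v ≠ (Fin.cons c₀ s : Fin (n + 1) → Fin k) →
      Reach (extendTable w ω) (Fin.cons c v) (Fin.cons c₀ u) := by
    intro c v hcv
    by_cases hc : c = c₀
    · subst hc
      exact reach_extendTable w ω c (hω0 ▸ hs2 v (by rintro rfl; exact hcv rfl) u)
    · have h1 : Reach (extendTable w ω) (Fin.cons c u) (Fin.cons c₀ u) := by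
        have := reach_extendTable_zero w ω c u
        rwa [hwu] at this
      by_cases hv : v = u
      · rw [hv]; exact h1
      · exact (reach_extendTable w ω c ((hω1 c hc).symm ▸ hu2 v hv u)).trans h1
  have hfrom : ∀ c v, Reach (extendTable w ω) (Fin.cons c₀ u) (Fin.cons c v) := by
    intro c v
    by_cases hc : c = c₀
    · subst hc
      exact reach_extendTable w ω c (hω0 ▸ hs2 u hu v)
    · have h1 := reach_extendTable w ω c₀ (hω0.symm ▸ hs2 u hu (e c))
      have h2 := reach_extendTable_zero w ω c₀ (e c)
      rw [hwe] at h2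
      exact h1.trans (h2.trans
        (reach_extendTable w ω c ((hω1 c hc).symm ▸ hu2 (e c) (hes' c).2 v)))
  refine ⟨extendTable w ω, fun i => ?_, fun a ha b => ?_⟩
  · refine Fin.cases ?_ (fun i => ?_) i
    · rw [extendTable_zero, hws]; rfl
    · rw [extendTable_succ, hω0, hs1]; simp
  · rw [← Fin.cons_self_tail a] at ha ⊢
    rw [← Fin.cons_self_tail b]
    exact (hto _ _ ha).trans (hfrom _ _)

/-! #### Explicit tables, given by numerals in base `k` -/

/-- The profile whose actions are the base-`k` digits of `c`. -/
def decode (n k : ℕ) [NeZero k] (c : ℕ) : Fin n → Fin k :=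
  fun i => ⟨c / k ^ (i : ℕ) % k, Nat.mod_lt _ (NeZero.pos k)⟩

/-- The table whose best responses of player `i` are the base-`k` digits of `T[i]`. -/
def digitTable (n k : ℕ) [NeZero k] (T : List ℕ) : Line n k → Fin k := fun l =>
  ⟨T.getD l.1 0 / k ^ (∑ j : Fin n, if h : j = l.1 then 0 else (l.2 ⟨j, h⟩ : ℕ) * k ^ (j : ℕ)) % k,
    Nat.mod_lt _ (NeZero.pos k)⟩

/-- The effect of a best response of player `d` on the codes of profiles. -/
def stepCode (k : ℕ) (T : List ℕ) (c d : ℕ) : ℕ :=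
  c - c / k ^ d % k * k ^ d + T.getD d 0 / k ^ (c - c / k ^ d % k * k ^ d) % k * k ^ d

/-- The codes visited when the players in a list respond one after the other. -/
def visited (k : ℕ) (T : List ℕ) : ℕ → List ℕ → List ℕ
  | c, [] => [c]
  | c, d :: ds => c :: visited k T (stepCode k T c d) ds

/-- `stepCode` describes the moves of `digitTable`. -/
def StepCodeCorrect (n k : ℕ) [NeZero k] (T : List ℕ) : Prop :=
  ∀ c : Fin (k ^ n), ∀ d : Fin n, stepCode k T c d < k ^ n ∧ ∀ j,
    decode n k (stepCode k T c d) j = Function.update (decode n k c) d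
      (digitTable n k T (lineOf d (decode n k c))) j

instance (n k : ℕ) [NeZero k] (T : List ℕ) : Decidable (StepCodeCorrect n k T) := by
  unfold StepCodeCorrect; infer_instance

theorem StepCodeCorrect.reach [NeZero k] {T : List ℕ} (hT : StepCodeCorrect n k T) {c d : ℕ}
    (hc : c < k ^ n) (hd : d < n) : stepCode k T c d < k ^ n ∧
      Reach (digitTable n k T) (decode n k c) (decode n k (stepCode k T c d)) := by
  obtain ⟨h1, h2⟩ := hT ⟨c, hc⟩ ⟨d, hd⟩
  refine ⟨h1, ?_⟩
  rw [show decode n k (stepCode k T c d) = _ from funext h2]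
  exact reach_update _ _ _

theorem StepCodeCorrect.visited [NeZero k] {T : List ℕ} (hT : StepCodeCorrect n k T)
    {ds : List ℕ} (hds : ∀ d ∈ ds, d < n) {c e : ℕ} (hc : c < k ^ n)
    (he : (visited k T c ds).getLast? = some e) :
    ∀ c' ∈ visited k T c ds, c' < k ^ n ∧
      Reach (digitTable n k T) (decode n k c) (decode n k c') ∧
      Reach (digitTable n k T) (decode n k c') (decode n k e) := by
  induction ds generalizing c with
  | nil =>
    intro c' hc'
    simp only [_root_.visited, List.mem_singleton, List.getLast?_singleton,
      Option.some.injEq] at hc' he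
    subst hc' he
    exact ⟨hc, Relation.ReflTransGen.refl, Relation.ReflTransGen.refl⟩
  | cons d ds ih =>
    obtain ⟨h1, h2⟩ := hT.reach hc (hds d (by simp))
    have hne : ∀ x, _root_.visited k T x ds ≠ [] := by
      intro x; cases ds <;> simp [_root_.visited]
    rw [_root_.visited, List.getLast?_cons_of_ne_nil (hne _)] at he
    have ih' := ih (fun d hd => hds d (by simp [hd])) h1 he
    intro c' hc'
    rcases List.mem_cons.1 hc' with rfl | hc'
    · refine ⟨hc, Relation.ReflTransGen.refl, h2.trans ?_⟩
      have : stepCode k T c' d ∈ _root_.visited k T (stepCode k T c' d) ds := by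
        cases ds <;> simp [_root_.visited]
      exact (ih' _ this).2.2
    · obtain ⟨h3, h4, h5⟩ := ih' c' hc'
      exact ⟨h3, h2.trans h4, h5⟩

theorem exists_decode_eq [NeZero k] (a : Fin n → Fin k) : ∃ c < k ^ n, decode n k c = a := by
  refine ⟨finFunctionFinEquiv a, (finFunctionFinEquiv a).2, ?_⟩
  have h := finFunctionFinEquiv.symm_apply_apply a
  funext i
  rw [← congrFun h i]
  rfl

theorem StepCodeCorrect.reach_of_mem [NeZero k] {T : List ℕ} (hT : StepCodeCorrect n k T)
    {ds : List ℕ} (hds : ∀ d ∈ ds, d < n) {r : ℕ} (hr : r < k ^ n)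
    (hlast : (_root_.visited k T r ds).getLast? = some r) {c c' : ℕ}
    (hc : c ∈ _root_.visited k T r ds) (hc' : c' ∈ _root_.visited k T r ds) :
    Reach (digitTable n k T) (decode n k c) (decode n k c') :=
  (hT.visited hds hr hlast c hc).2.2.trans (hT.visited hds hr hlast c' hc').2.1

/-- The list `ds` certifies a closed walk through every vertex except the sink `0`, so these are
mutually reachable; one exit from the walk to `0` completes the hub. -/
theorem StepCodeCorrect.isHub [NeZero k] {T : List ℕ} (hT : StepCodeCorrect n k T)
    {ds : List ℕ} (hds : ∀ d ∈ ds, d < n) {r : ℕ} (hr : r < k ^ n)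
    (hlast : (_root_.visited k T r ds).getLast? = some r)
    (hsink : ∀ i, digitTable n k T (lineOf i (decode n k 0)) = decode n k 0 i)
    (hall : ∀ c < k ^ n, c = 0 ∨ c ∈ _root_.visited k T r ds)
    (hexit : ∃ c ∈ _root_.visited k T r ds, ∃ d < n, stepCode k T c d = 0) :
    IsHub (digitTable n k T) (decode n k 0) := by
  refine ⟨hsink, fun a ha b => ?_⟩
  obtain ⟨c, hc, rfl⟩ := exists_decode_eq a
  obtain ⟨c', hc', rfl⟩ := exists_decode_eq b
  have h1 := (hall c hc).resolve_left (by rintro rfl; exact ha rfl)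
  rcases hall c' hc' with rfl | h2
  · obtain ⟨e, he, d, hd, h0⟩ := hexit
    have h3 := (hT.reach (hT.visited hds hr hlast e he).1 hd).2
    rw [h0] at h3
    exact (hT.reach_of_mem hds hr hlast h1 he).trans h3
  · exact hT.reach_of_mem hds hr hlast h1 h2

/-- Here the closed walk need not cover everything: each non-sink lies on it or steps onto it, and
each non-source lies on it or is one step after it. -/
theorem StepCodeCorrect.linked [NeZero k] {T : List ℕ} (hT : StepCodeCorrect n k T)
    {ds : List ℕ} (hds : ∀ d ∈ ds, d < n) {r : ℕ} (hr : r < k ^ n)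
    (hlast : (_root_.visited k T r ds).getLast? = some r)
    (hout : ∀ c < k ^ n, (∀ d < n, stepCode k T c d = c) ∨ c ∈ _root_.visited k T r ds ∨
      ∃ d < n, stepCode k T c d ∈ _root_.visited k T r ds)
    (hin : ∀ c < k ^ n, ∀ d < n, stepCode k T c d = c ∨
      stepCode k T c d ∈ _root_.visited k T r ds ∨
      ∃ c' ∈ _root_.visited k T r ds, ∃ d' < n, stepCode k T c' d' = stepCode k T c d) :
    digitTable n k T ∈ linkedTables n k := by
  have hmove : ∀ c < k ^ n, ∀ b, Move (digitTable n k T) (decode n k c) b → ∃ d < n,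
      stepCode k T c d ≠ c ∧ b = decode n k (stepCode k T c d) := by
    rintro c hc _ ⟨i, rfl, hne⟩
    have h2 := funext (hT ⟨c, hc⟩ i).2
    refine ⟨i, i.2, fun he => hne ?_, h2.symm⟩
    simp only at h2
    rw [he] at h2
    simpa using congrFun h2 i
  intro a b ⟨a', ha⟩ ⟨b', hb⟩
  obtain ⟨c, hc, rfl⟩ := exists_decode_eq a
  obtain ⟨c', hc', rfl⟩ := exists_decode_eq b'
  obtain ⟨d, hd, hne, -⟩ := hmove c hc _ ha
  obtain ⟨d', hd', hne', rfl⟩ := hmove c' hc' _ hb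
  have h1 : ∃ e ∈ _root_.visited k T r ds, Reach (digitTable n k T) (decode n k c) (decode n k e) := by
    rcases hout c hc with h | h | ⟨d, hd, h⟩
    · exact absurd (h d hd) hne
    · exact ⟨c, h, Relation.ReflTransGen.refl⟩
    · exact ⟨_, h, (hT.reach hc hd).2⟩
  have h2 : ∃ e ∈ _root_.visited k T r ds, Reach (digitTable n k T) (decode n k e)
      (decode n k (stepCode k T c' d')) := by
    rcases hin c' hc' d' hd' with h | h | ⟨e, he, d, hd, h⟩
    · exact absurd h hne'
    · exact ⟨_, h, Relation.ReflTransGen.refl⟩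
    · exact ⟨e, he, h ▸ (hT.reach (hT.visited hds hr hlast e he).1 hd).2⟩
  obtain ⟨e, he, h1⟩ := h1
  obtain ⟨e', he', h2⟩ := h2
  exact h1.trans ((hT.reach_of_mem hds hr hlast he he').trans h2)

theorem exists_isHub_of_isHub [NeZero k] {ω : Line n k → Fin k} {s : Fin n → Fin k}
    (h : IsHub ω s) (s' : Fin n → Fin k) : ∃ ω, IsHub ω s' :=
  ⟨_, by simpa using h.translate (s' - s)⟩

theorem exists_isHub_three_two (s : Fin 3 → Fin 2) : ∃ ω, IsHub ω s := by
  have hT : StepCodeCorrect 3 2 [80, 34, 4] := by decide +kernel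
  exact exists_isHub_of_isHub (hT.isHub (ds := [1, 0, 2, 0, 2, 0, 2, 1, 0, 2]) (r := 1)
    (by decide) (by decide) (by decide +kernel) (by decide +kernel) (by decide +kernel)
    (by decide +kernel)) s

/-- No hub exists here: its sink would be the best response on 3 of the 27 lines, and each of the 26
other vertices on at least one. Hence the induction for three actions starts at four players. -/
theorem linked_three_three : (nashTables 3 3 ∩ linkedTables 3 3).Nonempty := by
  have hT : StepCodeCorrect 3 3 [303364632645, 7361442009, 1929] := by decide +kernel
  refine ⟨_, ⟨decode 3 3 0, ?_⟩, hT.linked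
    (ds := [2, 0, 1, 0, 1, 0, 1, 2, 0, 1, 0, 1, 0, 1, 2, 1, 0, 2, 0, 2, 1, 0, 2, 1]) (r := 1)
    (by decide) (by decide) (by decide +kernel) (by decide +kernel) (by decide +kernel)⟩
  decide +kernel

theorem exists_isHub_four_three (s : Fin 4 → Fin 3) : ∃ ω, IsHub ω s := by
  have hT : StepCodeCorrect 4 3 [33499762258966921109044550755874690667,
    382999960915678196579058131899854897, 11978845822662062102009885331, 7176569590446] := by
    decide +kernel
  exact exists_isHub_of_isHub (hT.isHub (ds := [1, 0, 1, 0, 2, 0, 1, 0, 1, 0, 1, 3, 0, 3, 0, 1, 0, 1,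
    2, 1, 0, 1, 2, 0, 1, 0, 1, 0, 2, 0, 2, 1, 3, 0, 1, 0, 1, 3, 0, 1, 0, 2, 3, 0, 3, 0, 1, 0, 2, 0,
    1, 2, 1, 3, 1, 3, 0, 3, 1, 2, 0, 1, 3, 0, 1, 2, 1, 3, 0, 1, 3, 2, 0, 3, 1, 2, 3, 2, 3, 1, 0, 3,
    1, 3, 0, 3, 1, 2, 0, 2, 1, 2, 0, 1, 0, 3, 2, 3, 0, 2]) (r := 1)
    (by decide) (by decide) (by decide +kernel) (by decide +kernel) (by decide +kernel)
    (by decide +kernel)) s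

/-- In the coordination game both non-sinks move to both equilibria, which are the only non-sources.
-/
theorem linked_two_two : (nashTables 2 2 ∩ linkedTables 2 2).Nonempty := by
  let f : Fin 2 → (Fin 2 → Fin 2) → Fin 2 := fun i a => a (1 - i)
  have hne : ∀ i : Fin 2, 1 - i ≠ i := by decide
  let ω : Line 2 2 → Fin 2 := fun l => l.2 ⟨1 - l.1, hne l.1⟩
  have hω : ∀ i a, ω (lineOf i a) = a (1 - i) := fun _ _ => rfl
  refine ⟨ω, ⟨fun _ => 0, fun i => rfl⟩, ?_⟩
  rintro a _ ⟨_, i, rfl, hi⟩ ⟨b, i', rfl, hi'⟩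
  rw [hω] at hi hi' ⊢
  have key : ∀ (a b : Fin 2 → Fin 2) (i i' : Fin 2), a i ≠ a (1 - i) → ∃ j,
      Function.update b i' (b (1 - i')) = Function.update a j (a (1 - j)) := by decide
  obtain ⟨j, hj⟩ := key a b i i' hi
  rw [hj, ← hω j a]
  exact reach_update ω a j

theorem exists_isHub_two (m : ℕ) : ∀ s : Fin (m + 3) → Fin 2, ∃ ω, IsHub ω s := by
  induction m with
  | zero => exact exists_isHub_three_two
  | succ m ih =>
    refine exists_isHub_succ ?_ ih
    calc 2 + 2 ≤ 2 ^ 3 := by norm_num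
      _ ≤ 2 ^ (m + 3) := Nat.pow_le_pow_right (by norm_num) (by omega)

theorem exists_isHub_three (m : ℕ) : ∀ s : Fin (m + 4) → Fin 3, ∃ ω, IsHub ω s := by
  induction m with
  | zero => exact exists_isHub_four_three
  | succ m ih =>
    refine exists_isHub_succ ?_ ih
    calc 3 + 2 ≤ 3 ^ 4 := by norm_num
      _ ≤ 3 ^ (m + 4) := Nat.pow_le_pow_right (by norm_num) (by omega)

/-- A super-connected table exists for two actions, and for three actions and three players. -/
theorem nonempty_superConnected (hk : k = 2 ∨ k = 3) (hn : 2 ≤ n) (hnk : ¬ (n = 2 ∧ k = 3)) :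
    (nashTables n k ∩ linkedTables n k).Nonempty := by
  rcases hk with rfl | rfl
  · rcases Nat.lt_or_ge n 3 with h | h
    · obtain rfl : n = 2 := by omega
      exact linked_two_two
    · obtain ⟨m, rfl⟩ := Nat.exists_eq_add_of_le' h
      obtain ⟨ω, hω⟩ := exists_isHub_two m fun _ => 0
      exact ⟨ω, hω.mem⟩
  · rcases Nat.lt_or_ge n 4 with h | h
    · obtain rfl : n = 3 := by omega
      exact linked_three_three
    · obtain ⟨m, rfl⟩ := Nat.exists_eq_add_of_le' h
      obtain ⟨ω, hω⟩ := exists_isHub_three m fun _ => 0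
      exact ⟨ω, hω.mem⟩

end Existence

/-! ### Two or three actions -/

section Asymptotics

variable {n k : ℕ}

/-- Two distinct actions cannot both be the best response on a line; with at most one constraint
equality holds. -/
theorem card_forall_mem_singleton_le [NeZero k] (C : Finset (Fin k)) :
    ((Finset.univ.filter fun y => ∀ x ∈ C, y ∈ ({x} : Finset (Fin k))).card : ℝ) ≤
      k * (1 / k : ℝ) ^ C.card := by
  have hkr : (0 : ℝ) < k := by exact_mod_cast NeZero.pos k
  rcases Nat.lt_or_ge C.card 2 with h | h
  · interval_cases hC : C.card
    · exact (Nat.cast_le.2 (Finset.card_le_univ _)).trans (by simp)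
    · obtain ⟨x, rfl⟩ := Finset.card_eq_one.1 hC
      have : (Finset.univ.filter fun y => ∀ x' ∈ ({x} : Finset (Fin k)),
          y ∈ ({x'} : Finset (Fin k))) = {x} := by ext; simp
      rw [this, pow_one, mul_one_div_cancel hkr.ne']
      simp
  · obtain ⟨x, hx, y, hy, hxy⟩ := Finset.one_lt_card.1 h
    have : (Finset.univ.filter fun y => ∀ x ∈ C, y ∈ ({x} : Finset (Fin k))) = ∅ := by
      refine Finset.filter_eq_empty_iff.2 fun z _ hz => hxy ?_
      rw [← Finset.mem_singleton.1 (hz x hx), ← Finset.mem_singleton.1 (hz y hy)]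
    rw [this]
    simp only [Finset.card_empty, Nat.cast_zero]
    positivity

/-- Bernoulli's inequality, `1 - |C|/k ≤ (1 - 1/k)^|C|`. -/
theorem card_forall_mem_compl_le [NeZero k] (C : Finset (Fin k)) :
    ((Finset.univ.filter fun y => ∀ x ∈ C, y ∈ ({x}ᶜ : Finset (Fin k))).card : ℝ) ≤
      k * (1 - 1 / k : ℝ) ^ C.card := by
  have hkr : (0 : ℝ) < k := by exact_mod_cast NeZero.pos k
  have : (Finset.univ.filter fun y => ∀ x ∈ C, y ∈ ({x}ᶜ : Finset (Fin k))) = Cᶜ := by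
    ext y
    simp only [Finset.mem_filter, Finset.mem_univ, true_and, Finset.mem_compl,
      Finset.mem_singleton]
    exact ⟨fun h hy => h y hy rfl, fun h x hx hyx => h (hyx ▸ hx)⟩
  have hle : C.card ≤ k := by simpa using Finset.card_le_univ C
  have h1 : (1 / k : ℝ) ≤ 1 := by rw [div_le_one hkr]; exact_mod_cast NeZero.one_le
  have hb := one_add_mul_le_pow (a := -(1 / k : ℝ)) (by linarith) C.card
  rw [this, Finset.card_compl, Fintype.card_fin, Nat.cast_sub hle]
  calc (k - C.card : ℝ) = k * (1 + C.card * -(1 / k : ℝ)) := by field_simp; ring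
    _ ≤ k * (1 + -(1 / k : ℝ)) ^ C.card := by gcongr
    _ = _ := by rw [← sub_eq_add_neg]

theorem mul_add_two_le_two_pow {C h : ℕ} (hh : 20000 * (C + 1) ≤ h) :
    1000 * C * (h + 1) + 2 ≤ 2 ^ h := by
  have h1 : h / 2 < 2 ^ (h / 2) := Nat.lt_two_pow_self
  have h2 : (h / 2) * (h / 2) ≤ 2 ^ h := by
    calc (h / 2) * (h / 2) ≤ 2 ^ (h / 2) * 2 ^ (h / 2) := Nat.mul_le_mul h1.le h1.le
      _ = 2 ^ (h / 2 + h / 2) := (pow_add _ _ _).symm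
      _ ≤ 2 ^ h := Nat.pow_le_pow_right (by norm_num) (by omega)
  refine le_trans ?_ h2
  have h3 : 10000 * (C + 1) ≤ h / 2 := by omega
  have h4 : h + 1 ≤ 2 * (h / 2) + 2 := by omega
  generalize h / 2 = m at *
  nlinarith

/-- The error term for vertices of small degree. -/
theorem degree_error_le {β : ℝ} {R : ℕ} (hβ : 1 / 3 ≤ β)
    (hR : k * (β + 1 / 100) ^ R * (1007 / 1000) ^ R ≤ (95 / 100 : ℝ)) :
    (k ^ n * (n * k) ^ R : ℝ) *
      ((β + 1 / 100) ^ (n - n / 1000) * (1 / 100 : ℝ)⁻¹ ^ (n / 1000)) ^ R ≤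
      (n * k) ^ R * (95 / 100) ^ n := by
  set h := n / 1000 with hh
  set B : ℝ := β + 1 / 100 with hB
  have hB0 : 1 / 3 ≤ B := by linarith
  have h1 : B ^ (n - h) * (1 / 100 : ℝ)⁻¹ ^ h ≤ B ^ n * (1007 / 1000) ^ n := by
    have h2 : B ^ n = B ^ (n - h) * B ^ h := by rw [← pow_add]; congr 1; omega
    have h3 : ((1007 / 1000 : ℝ) ^ 1000) ^ h ≤ (1007 / 1000) ^ n := by
      rw [← pow_mul]
      exact pow_le_pow_right₀ (by norm_num) (by omega)
    -- Since `h` is at most a thousandth of `n`, a factor 1.007 per player pays for both the `h`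
    -- missing factors `B ≥ 1/3` and the `h` factors 100.
    have h4 : (1 / 100 : ℝ)⁻¹ ≤ B * (1007 / 1000) ^ 1000 := by
      have h6 : (2 : ℝ) ≤ (1007 / 1000) ^ 100 := by norm_num
      have : (300 : ℝ) ≤ (1007 / 1000) ^ 1000 := by
        calc (300 : ℝ) ≤ 2 ^ 10 := by norm_num
          _ ≤ ((1007 / 1000) ^ 100) ^ 10 := by gcongr
          _ = (1007 / 1000) ^ 1000 := by rw [← pow_mul]
      have h5 : (1 / 100 : ℝ)⁻¹ = 1 / 3 * 300 := by norm_num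
      rw [h5]
      exact mul_le_mul hB0 this (by norm_num) (by linarith)
    calc B ^ (n - h) * (1 / 100 : ℝ)⁻¹ ^ h ≤ B ^ (n - h) * (B * (1007 / 1000) ^ 1000) ^ h := by
          gcongr
      _ = B ^ n * ((1007 / 1000) ^ 1000) ^ h := by rw [h2, mul_pow, mul_assoc]
      _ ≤ _ := mul_le_mul_of_nonneg_left h3 (by positivity)
  calc _ ≤ (k ^ n * (n * k) ^ R : ℝ) * (B ^ n * (1007 / 1000) ^ n) ^ R := by gcongr
    _ = (n * k) ^ R * (k * B ^ R * (1007 / 1000) ^ R) ^ n := by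
        simp only [mul_pow, ← pow_mul]; ring
    _ ≤ _ := by gcongr

/-- The table of a game with two or three actions is linked, up to an exponentially small error. -/
theorem eventually_pr_compl_linkedTables_le (hk : k = 2 ∨ k = 3) {δ : ℝ} (hδ : 0 < δ) :
    ∀ᶠ n : ℕ in atTop, pr (linkedTables n k)ᶜ ≤ δ * (97 / 100) ^ n := by
  have hk2 : 2 ≤ k := by omega
  have hk3 : k ≤ 3 := by omega
  have : NeZero k := ⟨by omega⟩
  have hkr : (0 : ℝ) < k := by exact_mod_cast NeZero.pos k
  set p : ℝ := Real.exp (-(k ^ 2 : ℝ)) ^ 3 with hp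
  have hp0 : 0 < p := by positivity
  have hp1 : p ≤ 1 := pow_le_one₀ (Real.exp_pos _).le (Real.exp_le_one_iff.2 (by simp))
  -- With `C` attempts per player the failure probability beats the `k^(2n)` pairs.
  obtain ⟨C, hC⟩ := exists_pow_lt_of_lt_one (show (0 : ℝ) < 1 / (2 * k ^ 2) by positivity)
    (show 1 - p < 1 by linarith)
  have hlim : Tendsto (fun n : ℕ => (9 + 27 + 1) * ((n : ℝ) ^ 3 * (95 / 97 : ℝ) ^ n)) atTop
      (𝓝 ((9 + 27 + 1) * 0)) :=
    (tendsto_pow_const_mul_const_pow_of_lt_one 3 (by norm_num) (by norm_num)).const_mul _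
  rw [mul_zero] at hlim
  filter_upwards [hlim.eventually_le_const hδ, eventually_ge_atTop (1000 * (20000 * (C + 1)))]
    with n hn1 hn2
  set h := n / 1000 with hh
  have hh1 : 20000 * (C + 1) ≤ h := by omega
  have hnh : n ≤ 1000 * (h + 1) := by omega
  -- The `h` players off `K` provide `k^h` tags, exponentially many, while `K` keeps nearly all
  -- directions.
  let K : Finset (Fin n) := Finset.univ.filter fun i => h ≤ i
  have hKc : Kᶜ.card = h := by
    have h1 : Kᶜ = Finset.univ.filter fun i : Fin n => (i : ℕ) < h := by ext; simp [K]
    rw [h1, Fin.card_filter_val_lt]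
    omega
  have hK : K.card = n - h := by
    have := Finset.card_add_card_compl K
    rw [hKc, Fintype.card_fin] at this
    omega
  have hM : C * n + 2 ≤ k ^ Kᶜ.card := by
    rw [hKc]
    refine le_trans ?_ ((mul_add_two_le_two_pow hh1).trans (Nat.pow_le_pow_left hk2 h))
    nlinarith [Nat.mul_le_mul_left C hnh]
  have hMh : 8 * (C * n) ≤ (h + 2 - k) * h := by
    have h1 : h - 1 ≤ h + 2 - k := by omega
    refine le_trans ?_ (Nat.mul_le_mul_right h h1)
    obtain ⟨m, hm⟩ : ∃ m, h = m + 1 := ⟨h - 1, by omega⟩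
    rw [hm] at hh1 hnh ⊢
    have h2 : C * n ≤ C * (1000 * (m + 1 + 1)) := Nat.mul_le_mul_left C hnh
    have h3 : 16000 * C ≤ m := by omega
    calc 8 * (C * n) ≤ 8 * (C * (1000 * (m + 1 + 1))) := Nat.mul_le_mul_left 8 h2
      _ = 8000 * C * (m + 2) := by ring
      _ ≤ 8000 * C * (2 * (m + 1)) := Nat.mul_le_mul_left _ (by omega)
      _ = 16000 * C * (m + 1) := by ring
      _ ≤ m * (m + 1) := Nat.mul_le_mul_right _ h3
  have hmain := pr_compl_linkedTables_le hk2 K hM hMh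
  -- The last inequality is nearly tight for `k = 3`: 8/9 has grown to about 0.949.
  have hk1 : (1 / 3 : ℝ) ≤ 1 / k ∧ (1 / 3 : ℝ) ≤ 1 - 1 / k ∧
      k * (1 / k + 1 / 100 : ℝ) ^ 2 * (1007 / 1000) ^ 2 ≤ (95 / 100 : ℝ) ∧
      k * (1 - 1 / k + 1 / 100 : ℝ) ^ k * (1007 / 1000) ^ k ≤ (95 / 100 : ℝ) := by
    rcases hk with rfl | rfl <;> norm_num
  have hout := pr_not_spread_le (n := n) (la := 1 / 100) (by positivity) (by norm_num)
    (by norm_num) (card_forall_mem_singleton_le (k := k)) K h 2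
  have hin := pr_not_spread_le (n := n) (la := 1 / 100) (by linarith [hk1.2.1]) (by norm_num)
    (by norm_num) (card_forall_mem_compl_le (k := k)) K h k
  rw [hK] at hout hin
  replace hout := hout.trans (degree_error_le hk1.1 hk1.2.2.1)
  replace hin := hin.trans (degree_error_le hk1.2.1 hk1.2.2.2)
  have hn0 : (1 : ℝ) ≤ n := by exact_mod_cast (by omega : 1 ≤ n)
  have hk3r : (k : ℝ) ≤ 3 := by exact_mod_cast hk3
  have hk2r : (2 : ℝ) ≤ k := by exact_mod_cast hk2
  have e1 : ((n : ℝ) * k) ^ 2 ≤ 9 * (n : ℝ) ^ 3 := by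
    calc ((n : ℝ) * k) ^ 2 ≤ ((n : ℝ) * 3) ^ 2 := by gcongr
      _ = 9 * (n : ℝ) ^ 2 := by ring
      _ ≤ 9 * (n : ℝ) ^ 3 := by gcongr; norm_num
  have e2 : ((n : ℝ) * k) ^ k ≤ 27 * (n : ℝ) ^ 3 := by
    calc ((n : ℝ) * k) ^ k ≤ ((n : ℝ) * k) ^ 3 := pow_le_pow_right₀ (by nlinarith) hk3
      _ ≤ ((n : ℝ) * 3) ^ 3 := by gcongr
      _ = 27 * (n : ℝ) ^ 3 := by ring
  have e3 : (k ^ n * k ^ n : ℝ) * (1 - p) ^ (C * n) ≤ (n : ℝ) ^ 3 * (95 / 100) ^ n := by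
    have h1 : (k : ℝ) * k * (1 - p) ^ C ≤ 1 / 2 := by
      calc (k : ℝ) * k * (1 - p) ^ C ≤ k * k * (1 / (2 * k ^ 2)) := by gcongr
        _ = 1 / 2 := by field_simp
    have h0 : (0 : ℝ) ≤ (1 - p) ^ C := pow_nonneg (by linarith) C
    calc (k ^ n * k ^ n : ℝ) * (1 - p) ^ (C * n) = (k * k * (1 - p) ^ C) ^ n := by
          rw [mul_pow, mul_pow, pow_mul]
      _ ≤ (95 / 100) ^ n := pow_le_pow_left₀ (by positivity) (by linarith) n
      _ ≤ (n : ℝ) ^ 3 * (95 / 100) ^ n := le_mul_of_one_le_left (by positivity) (one_le_pow₀ hn0)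
  have e4 : (95 / 100 : ℝ) ^ n = (95 / 97) ^ n * (97 / 100) ^ n := by
    rw [← mul_pow]; norm_num
  have hq : (0 : ℝ) ≤ (95 / 100) ^ n := by positivity
  calc pr (linkedTables n k)ᶜ ≤ 9 * n ^ 3 * (95 / 100) ^ n + 27 * n ^ 3 * (95 / 100) ^ n +
        n ^ 3 * (95 / 100) ^ n := hmain.trans (add_le_add (add_le_add
          (hout.trans (mul_le_mul_of_nonneg_right e1 hq))
          (hin.trans (mul_le_mul_of_nonneg_right e2 hq))) e3)
    _ = ((9 + 27 + 1) * ((n : ℝ) ^ 3 * (95 / 97 : ℝ) ^ n)) * (97 / 100) ^ n := by rw [e4]; ring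
    _ ≤ _ := by gcongr

/-! ### From large numbers of players to all -/

theorem pr_pos_of_nonempty {Ω : Type*} [Finite Ω] {E : Set Ω} (h : E.Nonempty) : 0 < pr E := by
  have : Nonempty Ω := ⟨h.some⟩
  unfold pr
  have h1 : 0 < E.ncard := (Set.ncard_pos E.toFinite).2 h
  have h2 : 0 < Nat.card Ω := Nat.card_pos
  positivity

/-- The fraction is at least `1 - pr (linkedTables n k)ᶜ / pr (nashTables n k)`; the lower bound `δ`
for the denominator is cancelled by the factor `δ` in the error bound. -/
theorem eventually_le_superConnectedFraction (hk : k = 2 ∨ k = 3) :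
    ∀ᶠ n : ℕ in atTop, 1 - (97 / 100 : ℝ) ^ n ≤ superConnectedFraction n k := by
  have : NeZero k := ⟨by omega⟩
  have hδ := one_sub_exp_pos (k := k)
  filter_upwards [eventually_pr_compl_linkedTables_le hk hδ, eventually_ge_atTop 1] with n h1 h2
  obtain ⟨m, rfl⟩ := Nat.exists_eq_add_of_le' h2
  rw [superConnectedFraction_eq]
  have h3 := le_pr_nashTables (n := m) (k := k)
  set δ := 1 - Real.exp (-(1 / k : ℝ))
  have h4 : pr (nashTables (m + 1) k) ≤
      pr (nashTables (m + 1) k ∩ linkedTables (m + 1) k) + pr (linkedTables (m + 1) k)ᶜ :=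
    (pr_mono (fun ω hω => by
      by_cases h : ω ∈ linkedTables (m + 1) k
      exacts [Or.inl ⟨hω, h⟩, Or.inr h])).trans (pr_union_le _ _)
  rw [le_div_iff₀ (hδ.trans_le h3)]
  have h5 : δ * (97 / 100 : ℝ) ^ (m + 1) ≤ (97 / 100) ^ (m + 1) * pr (nashTables (m + 1) k) := by
    rw [mul_comm]; gcongr
  linarith

theorem superConnectedFraction_pos (hk : k = 2 ∨ k = 3) (hn : 2 ≤ n) (hnk : ¬ (n = 2 ∧ k = 3)) :
    0 < superConnectedFraction n k := by
  have : NeZero k := ⟨by omega⟩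
  have h := nonempty_superConnected hk hn hnk
  rw [superConnectedFraction_eq]
  exact div_pos (pr_pos_of_nonempty h) (pr_pos_of_nonempty (h.mono Set.inter_subset_left))

theorem exists_pos_le_of_forall_lt {P : ℕ → Prop} {ρ : ℕ → ℝ} (h : ∀ n, P n → 0 < ρ n) (N : ℕ) :
    ∃ ε : ℝ, 0 < ε ∧ ∀ n < N, P n → ε ≤ ρ n := by
  induction N with
  | zero => exact ⟨1, one_pos, fun n hn => absurd hn (Nat.not_lt_zero n)⟩
  | succ N ih =>
    obtain ⟨ε, hε, h1⟩ := ih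
    by_cases hP : P N
    · refine ⟨min ε (ρ N), lt_min hε (h N hP), fun n hn hPn => ?_⟩
      rcases Nat.lt_succ_iff_lt_or_eq.1 hn with hn | rfl
      · exact (min_le_left _ _).trans (h1 n hn hPn)
      · exact min_le_right _ _
    · refine ⟨ε, hε, fun n hn hPn => ?_⟩
      rcases Nat.lt_succ_iff_lt_or_eq.1 hn with hn | rfl
      · exact h1 n hn hPn
      · exact absurd hPn hP

/-- A sequence of positive numbers that converges to `1` exponentially fast is bounded below by
`1 - exp (-c n)` from the start. -/
theorem exists_one_sub_exp_le {P : ℕ → Prop} {ρ : ℕ → ℝ} {r : ℝ} (hr0 : 0 < r) (hr1 : r < 1)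
    (hpos : ∀ n, P n → 0 < ρ n) (hev : ∀ᶠ n in atTop, 1 - r ^ n ≤ ρ n) :
    ∃ c : ℝ, 0 < c ∧ ∀ n : ℕ, P n → 1 - Real.exp (-(c * n)) ≤ ρ n := by
  obtain ⟨N, hN⟩ := eventually_atTop.1 hev
  obtain ⟨ε, hε, hε'⟩ := exists_pos_le_of_forall_lt hpos N
  have hlog : 0 < -Real.log r := by have := Real.log_neg hr0 hr1; linarith
  -- The first term serves `n ≥ N`; the second makes `1 - exp (-c n) ≤ c n ≤ ε` for `n < N`.
  refine ⟨min (-Real.log r) (ε / (N + 1)), lt_min hlog (by positivity), fun n hP => ?_⟩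
  set c := min (-Real.log r) (ε / (N + 1)) with hc
  have hn0 : (0 : ℝ) ≤ n := Nat.cast_nonneg n
  rcases Nat.lt_or_ge n N with h | h
  · refine le_trans ?_ (hε' n h hP)
    have h1 : 1 - Real.exp (-(c * n)) ≤ c * n := by linarith [Real.add_one_le_exp (-(c * n))]
    have h2 : c * n ≤ ε / (N + 1) * (N + 1) := by
      have : (n : ℝ) ≤ N + 1 := by exact_mod_cast (by omega : n ≤ N + 1)
      exact mul_le_mul (min_le_right _ _) this hn0 (by positivity)
    rw [div_mul_cancel₀ _ (by positivity)] at h2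
    exact h1.trans h2
  · refine le_trans ?_ (hN n h)
    have h1 : r ^ n ≤ Real.exp (-(c * n)) := by
      rw [← Real.exp_log hr0, ← Real.exp_nat_mul]
      apply Real.exp_le_exp.2
      have := mul_le_mul_of_nonneg_right (min_le_left (-Real.log r) (ε / (N + 1))) hn0
      rw [← hc] at this
      linarith
    linarith

end Asymptotics

theorem proposition3 :
    (∀ k : ℕ, k = 2 ∨ k = 3 →
      ∃ c : ℝ, 0 < c ∧ ∀ n : ℕ, 2 ≤ n → ¬ (n = 2 ∧ k = 3) →
        1 - Real.exp (-(c * n)) ≤ superConnectedFraction n k) ∧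
    (∀ k : ℕ, 4 ≤ k →
      Tendsto (fun n : ℕ => superConnectedFraction n k) atTop (𝓝 0)) := by
  refine ⟨fun k hk => ?_, fun k hk => tendsto_superConnectedFraction hk⟩
  obtain ⟨c, hc, h⟩ := exists_one_sub_exp_le (P := fun n => 2 ≤ n ∧ ¬ (n = 2 ∧ k = 3))
    (by norm_num) (by norm_num) (fun n hn => superConnectedFraction_pos hk hn.1 hn.2)
    (eventually_le_superConnectedFraction hk)
  exact ⟨c, hc, fun n h1 h2 => h n ⟨h1, h2⟩⟩
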